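/- **Notation.** For $\alpha\in\mathbf N^d$ let $h_\alpha(x)=\pi^{-d/4}(-1)^{|\alpha|}(2^{|\alpha|}\alpha!)^{-1/2}e^{|x|^2/2}\,\partial^\alpha e^{-|x|^2}$ be the Hermite functions on $\mathbf R^d$, and $c_h(f,\alpha)=(f,h_\alpha)_{L^2(\mathbf R^d)}$. For $r\in\mathbf R_+^d$ put $$\vartheta_{r,s}(\alpha)=e^{-\sum_j \alpha_j^{1/(2s)}/r_j}\ (s>0,\ s\ne\tfrac12),\qquad \vartheta_{r,\flat_\sigma}(\alpha)=r^\alpha\alpha!^{-1/(2\sigma)}\ (\sigma>0),\qquad \vartheta_{r,1/2}(\alpha)=r^\alpha,$$ $$\vartheta'_{r,\flat_\sigma}(\alpha)=r^\alpha\alpha!^{1/(2\sigma)},\qquad \vartheta'_{r,1/2}(\alpha)=r^\alpha .$$ The space $\mathcal H_s(\mathbf R^d)$ (resp. $\mathcal H_{0,s}(\mathbf R^d)$) consists of all $f\in L^2(\mathbf R^d)$ such that $|c_h(f,\alpha)|\lesssim\vartheta_{r,s}(\alpha)$ for some (resp. every) $r\in\mathbf R_+^d$, where $s>0$ or $s=\flat_\sigma$.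 Identify a power series $F_0(z)=\sum_\alpha c(\alpha)\,z^\alpha/\sqrt{\alpha!}$ on $\mathbf C^d$ with its coefficients $c$. Then $F_0\in\mathcal A_s$ (resp. $\mathcal A_{0,s}$) means $|c(\alpha)|\lesssim\vartheta_{r,s}(\alpha)$ for some (resp. every) $r\in\mathbf R^d_+$, and $F_0\in\mathcal A'_s$ (resp. $\mathcal A'_{0,s}$) means $|c(\alpha)|\lesssim\vartheta'_{r,s}(\alpha)$ for every (resp. some) $r\in\mathbf R^d_+$. In all cases below these series converge on $\mathbf C^d$, so that $F_0$ is an entire function. Let $\mathcal R^\infty(\mathbf C^d)$ be the set of all non-negative $\chi\in L^\infty(\mathbf C^d)$ of the form $\chi(z)=\chi_0(|z_1|,\dots,|z_d|)$ for which there are $t_1\le t_2$ in $\mathbf R_+^d$ and $c>0$ such that $\chi$ vanishes outside the closed polydisc with centre $0$ and radii $t_2$, and $\chi\ge c$ on the open polydisc with centre $0$ and radii $t_1$. We write $\chi(x,\xi)=\chi(x+i\xi)$. Let $\phi(x)=\pi^{-d/4}e^{-|x|^2/2}$ and $$V_\phi^*F(x)=\iint_{\mathbf R^{2d}}F(y,\eta)\,\phi(x-y)\,e^{i\langle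 x,\eta\rangle}\,dy\,d\eta ,$$ the adjoint of the short-time Fourier transform $V_\phi f(x,\xi)=\int f(t)\phi(t-x)e^{-i\langle t,\xi\rangle}dt$. For $\theta\in\mathbf R$, a class $\mathcal A$ of power series as above and $\chi\in\mathcal R^\infty(\mathbf C^d)$, say that $f$ is *$(\theta,\chi)$-represented by $\mathcal A$* if $f=V_\phi^*F$ for some essentially bounded and compactly supported $F$ on $\mathbf R^{2d}$ such that $$F(x,\xi)=F_0(x-i\xi)\,e^{-i\theta\langle x,\xi\rangle}\,\chi(x,\xi)\quad\text{for some }F_0\in\mathcal A .$$ Equalities between functions are understood almost everywhere. **Proposition.** Let $\chi\in\mathcal R^\infty(\mathbf C^d)$ and let $f$ be a function on $\mathbf R^d$. 1. Let $\sigma\in(\frac12,1)$, $\sigma_0=\frac{\sigma}{2\sigma-1}$ and $\theta\in\{1,\frac12\}$. Then $f\in\mathcal H_{\flat_\sigma}$ (resp. $f\in\mathcal H_{0,\flat_\sigma}$) if and only if $f$ is $(\theta,\chi)$-represented by $\mathcal A'_{0,\flat_{\sigma_0}}$ (resp. $\mathcal A'_{\flat_{\sigma_0}}$). 2. For $\theta\in\{1,\frac12\}$,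 $f\in\mathcal H_{\flat_{1/2}}$ if and only if $f$ is $(\theta,\chi)$-represented by $\mathcal A'_{0,1/2}$. Moreover, $f\in\mathcal H_{0,\flat_{1/2}}$ if and only if $f$ is $(\frac12,\chi)$-represented by $\mathcal A_{0,1/2}$. 3. Let $\sigma\in(0,\frac12)$ and $\sigma_0=\frac{\sigma}{1-2\sigma}$. Then $f\in\mathcal H_{\flat_\sigma}$ (resp. $f\in\mathcal H_{0,\flat_\sigma}$) if and only if $f$ is $(\frac12,\chi)$-represented by $\mathcal A_{\flat_{\sigma_0}}$ (resp. $\mathcal A_{0,\flat_{\sigma_0}}$). 4. Let $s\in(0,\frac12)$. Then $f\in\mathcal H_s$ (resp. $f\in\mathcal H_{0,s}$) if and only if $f$ is $(\frac12,\chi)$-represented by $\mathcal A_s$ (resp. $\mathcal A_{0,s}$). -/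

import Mathlib

open MeasureTheory
open scoped ENNReal

noncomputable section

namespace Pilipovic

/-! ### Orders and weights on multi-indices -/

/-- The extended set of orders: `real s` is the order `s ∈ ℝ₊`, and `flat σ` is the order `♭_σ`. -/
inductive Order : Type where
  | real (s : ℝ) : Order
  | flat (σ : ℝ) : Order

/-- `r ∈ ℝ₊ᵈ`. -/
def Pos {d : ℕ} (r : Fin d → ℝ) : Prop := ∀ j, 0 < r j

/-- `α! = α₁! ⋯ α_d!`. -/
def multiFactorial {d : ℕ} (α : Fin d → ℕ) : ℕ := ∏ j, (α j).factorial

/-- The weight `ϑ_{r,s}(α)`. -/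
def weight {d : ℕ} (r : Fin d → ℝ) : Order → (Fin d → ℕ) → ℝ
  | .real s, α =>
      if s = 1 / 2 then ∏ j, r j ^ α j
      else Real.exp (-∑ j, (1 / r j) * (α j : ℝ) ^ (1 / (2 * s)))
  | .flat σ, α => (∏ j, r j ^ α j) * (multiFactorial α : ℝ) ^ (-(1 / (2 * σ)))

/-- The weight `ϑ'_{r,s}(α)`. -/
def dualWeight {d : ℕ} (r : Fin d → ℝ) : Order → (Fin d → ℕ) → ℝ
  | .real s, α =>
      if s = 1 / 2 then ∏ j, r j ^ α j
      else Real.exp (∑ j, (1 / r j) * (α j : ℝ) ^ (1 / (2 * s)))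
  | .flat σ, α => (∏ j, r j ^ α j) * (multiFactorial α : ℝ) ^ (1 / (2 * σ))

/-- `|c(α)| ≲ ϑ(α)`: the estimate holds up to a multiplicative constant independent of `α`. -/
def DominatedBy {d : ℕ} (c : (Fin d → ℕ) → ℂ) (ϑ : (Fin d → ℕ) → ℝ) : Prop :=
  ∃ C : ℝ, ∀ α, ‖c α‖ ≤ C * ϑ α

/-! ### Hermite functions and Pilipović spaces -/

/-- The one-dimensional Hermite function
`h_n(t) = π^{-1/4} (-1)^n (2^n n!)^{-1/2} e^{t²/2} (d/dt)^n e^{-t²}`. -/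
def hermiteFun (n : ℕ) (t : ℝ) : ℝ :=
  Real.pi ^ (-(1 / 4) : ℝ) * (-1) ^ n * ((2 : ℝ) ^ n * (n.factorial : ℝ)) ^ (-(1 / 2) : ℝ)
    * Real.exp (t ^ 2 / 2) * iteratedDeriv n (fun u : ℝ => Real.exp (-u ^ 2)) t

/-- The Hermite function `h_α` on `ℝᵈ`. Since `e^{-|x|²}` is a product of functions of the
separate coordinates, `∂^α` factorizes and `h_α(x) = h_{α₁}(x₁) ⋯ h_{α_d}(x_d)`. -/
def hermite {d : ℕ} (α : Fin d → ℕ) (x : Fin d → ℝ) : ℝ := ∏ j, hermiteFun (α j) (x j)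

/-- The Hermite coefficient `c_h(f, α) = (f, h_α)_{L²(ℝᵈ)}`. -/
def hermiteCoeff {d : ℕ} (f : (Fin d → ℝ) → ℂ) (α : Fin d → ℕ) : ℂ :=
  ∫ x, f x * (hermite α x : ℂ)

/-- The Pilipović space `𝓗_s(ℝᵈ)` of Roumieu type. -/
def H (d : ℕ) (s : Order) : Set ((Fin d → ℝ) → ℂ) :=
  {f | MemLp f 2 volume ∧ ∃ r : Fin d → ℝ, Pos r ∧ DominatedBy (hermiteCoeff f) (weight r s)}

/-- The Pilipović space `𝓗_{0,s}(ℝᵈ)` of Beurling type. -/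
def H₀ (d : ℕ) (s : Order) : Set ((Fin d → ℝ) → ℂ) :=
  {f | MemLp f 2 volume ∧ ∀ r : Fin d → ℝ, Pos r → DominatedBy (hermiteCoeff f) (weight r s)}

/-! ### Spaces of power series expansions

A formal power series `∑ c(α) e_α`, `e_α(z) = z^α / √α!`, on `ℂᵈ` is identified with its family
of coefficients `c`. -/

/-- The normalized monomial `e_α(z) = z^α / √α!`. -/
def monomial {d : ℕ} (α : Fin d → ℕ) (z : Fin d → ℂ) : ℂ :=
  (∏ j, z j ^ α j) / (Real.sqrt (multiFactorial α) : ℂ)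

/-- The formal power series with coefficients `c` converges (unconditionally) on all of `ℂᵈ`,
and its sum is the function `F`. -/
def IsSum {d : ℕ} (c : (Fin d → ℕ) → ℂ) (F : (Fin d → ℂ) → ℂ) : Prop :=
  ∀ z, HasSum (fun α => c α * monomial α z) (F z)

/-- `𝓐_s(ℂᵈ)`. -/
def A (d : ℕ) (s : Order) : Set ((Fin d → ℕ) → ℂ) :=
  {c | ∃ r : Fin d → ℝ, Pos r ∧ DominatedBy c (weight r s)}

/-- `𝓐_{0,s}(ℂᵈ)`. -/
def A₀ (d : ℕ) (s : Order) : Set ((Fin d → ℕ) → ℂ) :=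
  {c | ∀ r : Fin d → ℝ, Pos r → DominatedBy c (weight r s)}

/-- `𝓐'_s(ℂᵈ)`. -/
def ADual (d : ℕ) (s : Order) : Set ((Fin d → ℕ) → ℂ) :=
  {c | ∀ r : Fin d → ℝ, Pos r → DominatedBy c (dualWeight r s)}

/-- `𝓐'_{0,s}(ℂᵈ)`. -/
def A₀Dual (d : ℕ) (s : Order) : Set ((Fin d → ℕ) → ℂ) :=
  {c | ∃ r : Fin d → ℝ, Pos r ∧ DominatedBy c (dualWeight r s)}

/-! ### The class `𝓡^∞` -/

/-- The class `𝓡^∞_{t₁,t₂}(ℂᵈ)`; elements of `L^∞` are represented by functions, so all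
conditions are imposed almost everywhere. -/
def RClassWith {d : ℕ} (t₁ t₂ : Fin d → ℝ) : Set ((Fin d → ℂ) → ℝ) :=
  {χ | MemLp χ ∞ volume ∧
    (∀ᵐ z, 0 ≤ χ z) ∧
    (∀ᵐ z : Fin d → ℂ, ¬ (∀ j, ‖z j‖ ≤ t₂ j) → χ z = 0) ∧
    (∃ χ₀ : (Fin d → ℝ) → ℝ, ∀ᵐ z, χ z = χ₀ (fun j => ‖z j‖)) ∧
    ∃ c : ℝ, 0 < c ∧ ∀ᵐ z : Fin d → ℂ, (∀ j, ‖z j‖ < t₁ j) → c ≤ χ z}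

/-- The class `𝓡^∞(ℂᵈ)`. -/
def RClass (d : ℕ) : Set ((Fin d → ℂ) → ℝ) :=
  {χ | ∃ t₁ t₂ : Fin d → ℝ, Pos t₁ ∧ Pos t₂ ∧ t₁ ≤ t₂ ∧ χ ∈ RClassWith t₁ t₂}

/-! ### The adjoint of the short-time Fourier transform -/

/-- `⟨x, ξ⟩` on `ℝᵈ`. -/
def dot {d : ℕ} (x ξ : Fin d → ℝ) : ℝ := ∑ j, x j * ξ j

/-- The Gaussian window `φ(x) = π^{-d/4} e^{-|x|²/2}`. -/
def gaussian {d : ℕ} (x : Fin d → ℝ) : ℝ :=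
  Real.pi ^ (-(d : ℝ) / 4) * Real.exp (-(dot x x) / 2)

/-- `V_φ f(x, ξ) = ∫ f(t) φ(t - x) e^{-i⟨t, ξ⟩} dt`. -/
def stft {d : ℕ} (f : (Fin d → ℝ) → ℂ) (p : (Fin d → ℝ) × (Fin d → ℝ)) : ℂ :=
  ∫ t, f t * (gaussian (t - p.1) : ℂ) * Complex.exp (-(Complex.I * (dot t p.2 : ℂ)))

/-- `V_φ^* F(x) = ∬ F(y, η) φ(x - y) e^{i⟨x, η⟩} dy dη`. -/
def stftAdjoint {d : ℕ} (F : (Fin d → ℝ) × (Fin d → ℝ) → ℂ) (x : Fin d → ℝ) : ℂ :=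
  ∫ p : (Fin d → ℝ) × (Fin d → ℝ),
    F p * (gaussian (x - p.1) : ℂ) * Complex.exp (Complex.I * (dot x p.2 : ℂ))

/-- `F ∈ L^∞(ℝ²ᵈ) ∩ 𝓔'(ℝ²ᵈ)`: essentially bounded, and zero almost everywhere outside some
compact set. -/
def IsBoundedCompact {d : ℕ} (F : (Fin d → ℝ) × (Fin d → ℝ) → ℂ) : Prop :=
  MemLp F ∞ volume ∧
    ∃ K : Set ((Fin d → ℝ) × (Fin d → ℝ)), IsCompact K ∧ ∀ᵐ p, p ∉ K → F p = 0

/-- The function `(x, ξ) ↦ F₀(x - iξ) e^{-iθ⟨x, ξ⟩} χ(x, ξ)` on `ℝ²ᵈ ≃ ℂᵈ`. -/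
def cutoff {d : ℕ} (θ : ℝ) (χ : (Fin d → ℂ) → ℝ) (F₀ : (Fin d → ℂ) → ℂ)
    (p : (Fin d → ℝ) × (Fin d → ℝ)) : ℂ :=
  F₀ (fun j => (p.1 j : ℂ) - Complex.I * (p.2 j : ℂ))
    * Complex.exp (-(Complex.I * (θ : ℂ) * (dot p.1 p.2 : ℂ)))
    * (χ (fun j => (p.1 j : ℂ) + Complex.I * (p.2 j : ℂ)) : ℂ)

/-- `f = V_φ^* F` for some `F ∈ L^∞(ℝ²ᵈ) ∩ 𝓔'(ℝ²ᵈ)` of the form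
`F(x, ξ) = F₀(x - iξ) e^{-iθ⟨x, ξ⟩} χ(x, ξ)`, with `F₀` in the space `S` of power series. -/
def HasRepresentation {d : ℕ} (θ : ℝ) (χ : (Fin d → ℂ) → ℝ) (S : Set ((Fin d → ℕ) → ℂ))
    (f : (Fin d → ℝ) → ℂ) : Prop :=
  ∃ F : (Fin d → ℝ) × (Fin d → ℝ) → ℂ, IsBoundedCompact F ∧
    (∃ c ∈ S, ∃ F₀ : (Fin d → ℂ) → ℂ, IsSum c F₀ ∧ F =ᵐ[volume] cutoff θ χ F₀) ∧
    f =ᵐ[volume] stftAdjoint F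

/-- `stftAdjoint` is the `L²`-adjoint of `stft`: `(V_φ h, F) = (h, V_φ^* F)`. -/
theorem stft_adjoint {d : ℕ} (h : (Fin d → ℝ) → ℂ) (F : (Fin d → ℝ) × (Fin d → ℝ) → ℂ)
    (hh : Integrable h) (hF : Integrable F) :
    ∫ p, stft h p * star (F p) = ∫ x, h x * star (stftAdjoint F x) := by
  have hg : ∀ x : Fin d → ℝ, ‖(gaussian x : ℂ)‖ ≤ Real.pi ^ (-(d : ℝ) / 4) := by
    intro x
    have h0 : 0 ≤ dot x x := Finset.sum_nonneg fun j _ => mul_self_nonneg _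
    have hp : (0 : ℝ) ≤ Real.pi ^ (-(d : ℝ) / 4) := Real.rpow_nonneg Real.pi_pos.le _
    rw [Complex.norm_real, Real.norm_eq_abs, gaussian, abs_of_nonneg (by positivity)]
    exact mul_le_of_le_one_right hp (Real.exp_le_one_iff.2 (by linarith))
  set k : (Fin d → ℝ) → (Fin d → ℝ) × (Fin d → ℝ) → ℂ := fun t p =>
    (gaussian (t - p.1) : ℂ) * Complex.exp (-(Complex.I * (dot t p.2 : ℂ))) with hk
  have hkn : ∀ t p, ‖k t p‖ ≤ Real.pi ^ (-(d : ℝ) / 4) := by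
    intro t p
    have : ‖Complex.exp (-(Complex.I * (dot t p.2 : ℂ)))‖ = 1 := by
      rw [Complex.norm_exp]; simp
    simp only [hk, norm_mul, this, mul_one]
    exact hg _
  have hkc : Continuous fun q : ((Fin d → ℝ) × (Fin d → ℝ)) × (Fin d → ℝ) => k q.2 q.1 := by
    simp only [hk, gaussian, dot]
    fun_prop
  have hint : Integrable (fun q : ((Fin d → ℝ) × (Fin d → ℝ)) × (Fin d → ℝ) =>
      (star (F q.1) * h q.2) * k q.2 q.1) (volume.prod volume) := by
    refine Integrable.mul_bdd (c := Real.pi ^ (-(d : ℝ) / 4)) ?_ hkc.aestronglyMeasurable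
      (Filter.Eventually.of_forall fun q => hkn _ _)
    have hF' : Integrable (fun p => star (F p)) := by
      simpa using (Complex.conjCLE.toContinuousLinearMap.integrable_comp hF)
    exact hF'.mul_prod hh
  calc ∫ p, stft h p * star (F p)
      = ∫ p, ∫ t, (star (F p) * h t) * k t p := by
        congr 1; ext p
        rw [stft, ← integral_mul_const]
        congr 1; ext t; simp only [hk]; ring
    _ = ∫ t, ∫ p, (star (F p) * h t) * k t p := integral_integral_swap hint
    _ = ∫ x, h x * star (stftAdjoint F x) := by
        congr 1; ext t
        simp only [stftAdjoint, Complex.star_def]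
        rw [← integral_conj, ← integral_const_mul]
        congr 1; ext p
        simp only [hk, map_mul, Complex.conj_ofReal, ← Complex.exp_conj, Complex.conj_I]
        ring_nf

end Pilipovic

end

/-!
Write `F = cutoff θ χ F₀`. Pairing `V_φ^* F` with the generating function of the Hermite functions
shows that `√(2^{|α|} α!)` times the Hermite coefficient of `V_φ^* F` is, for `θ = 1/2`, the
integral of `F₀(z̄) z^α χ(z) e^{-|z|²/4}` over `ℂᵈ`. Since `χ` depends only on the moduli `|z_j|`,
distinct monomials are orthogonal and the integral equals the `α`-th Taylor coefficient of `F₀`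
times the moment of `|z^α|²` for `χ(z) e^{-|z|²/4}`. The moments lie between two geometric
sequences because `χ` is bounded, has compact support and is bounded below near the origin. Hence
multiplication by the moments preserves the weight classes, the two factors `√α!` shift the
exponent of `α!` in the weights, and completeness of the Hermite functions identifies `f` with
`V_φ^* F`.

For other `θ` the integrand acquires the factor `e^{ε⟨z̄, z̄⟩} e^{-ε⟨z, z⟩}`. Its first half acts on
the Taylor coefficients of `F₀` by a Cauchy product, its second half by the transpose of one; both
operators are invertible, with `-ε` in place of `ε`, and preserve the weight classes as long as the
exponent of `α!` is at most `1/2`.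
-/

noncomputable section

namespace Pilipovic

section MultiIndexPower

variable {ι R : Type*} [Fintype ι]

/-- The multi-index power `x^α = ∏ j, x_j^{α_j}`. -/
def mpow [CommMonoid R] (x : ι → R) (α : ι → ℕ) : R := ∏ j, x j ^ α j

theorem mpow_add [CommMonoid R] (x : ι → R) (α β : ι → ℕ) :
    mpow x (α + β) = mpow x α * mpow x β := by
  simp only [mpow, Pi.add_apply, pow_add, Finset.prod_mul_distrib]

theorem mul_mpow [CommMonoid R] (x y : ι → R) (α : ι → ℕ) :
    mpow (x * y) α = mpow x α * mpow y α := by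
  simp only [mpow, Pi.mul_apply, mul_pow, Finset.prod_mul_distrib]

theorem one_mpow [CommMonoid R] (α : ι → ℕ) : mpow (1 : ι → R) α = 1 := by
  simp only [mpow, Pi.one_apply, one_pow, Finset.prod_const_one]

theorem norm_mpow (z : ι → ℂ) (α : ι → ℕ) : ‖mpow z α‖ = mpow (fun j => ‖z j‖) α := by
  simp only [mpow, norm_prod, norm_pow]

theorem mpow_nonneg {x : ι → ℝ} (hx : 0 ≤ x) (α : ι → ℕ) : 0 ≤ mpow x α :=
  Finset.prod_nonneg fun j _ => pow_nonneg (hx j) _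

theorem mpow_le_mpow_left {x y : ι → ℝ} (hx : 0 ≤ x) (h : x ≤ y) (α : ι → ℕ) :
    mpow x α ≤ mpow y α :=
  Finset.prod_le_prod (fun j _ => pow_nonneg (hx j) _) fun j _ => pow_le_pow_left₀ (hx j) (h j) _

theorem norm_mpow_le {t : ι → ℝ} {z : ι → ℂ} (hz : ∀ j, ‖z j‖ ≤ t j) (α : ι → ℕ) :
    ‖mpow z α‖ ≤ mpow t α :=
  (norm_mpow z α).trans_le (mpow_le_mpow_left (fun j => norm_nonneg (z j)) hz α)

theorem one_le_mpow {x : ι → ℝ} (hx : 1 ≤ x) (α : ι → ℕ) : 1 ≤ mpow x α :=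
  Finset.one_le_prod fun j _ => one_le_pow₀ (hx j)

theorem continuous_mpow (α : ι → ℕ) : Continuous fun z : ι → ℂ => mpow z α := by
  unfold mpow
  fun_prop

end MultiIndexPower

variable {d : ℕ}

namespace Pos

theorem nonneg {r : Fin d → ℝ} (hr : Pos r) : 0 ≤ r := fun j => (hr j).le

theorem mul {r s : Fin d → ℝ} (hr : Pos r) (hs : Pos s) : Pos (r * s) :=
  fun j => mul_pos (hr j) (hs j)

theorem inv {r : Fin d → ℝ} (hr : Pos r) : Pos r⁻¹ := fun j => inv_pos.2 (hr j)

theorem one : Pos (1 : Fin d → ℝ) := fun _ => one_pos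

theorem two : Pos (2 : Fin d → ℝ) := fun _ => two_pos

theorem sqrt_two : Pos fun _ : Fin d => √2 := fun _ => Real.sqrt_pos.2 two_pos

theorem mpow {r : Fin d → ℝ} (hr : Pos r) (α : Fin d → ℕ) : 0 < mpow r α :=
  Finset.prod_pos fun j _ => pow_pos (hr j) _

theorem inv_mul_cancel {r : Fin d → ℝ} (hr : Pos r) (s : Fin d → ℝ) : r⁻¹ * (r * s) = s :=
  funext fun j => inv_mul_cancel_left₀ (hr j).ne' (s j)

theorem mul_inv_cancel {r : Fin d → ℝ} (hr : Pos r) (s : Fin d → ℝ) : r * (r⁻¹ * s) = s :=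
  funext fun j => mul_inv_cancel_left₀ (hr j).ne' (s j)

end Pos

theorem mpow_inv_mul_mpow {r : Fin d → ℝ} (hr : Pos r) (α : Fin d → ℕ) :
    mpow r⁻¹ α * mpow r α = 1 := by
  rw [← mul_mpow, ← one_mpow α]
  exact congrArg (mpow · α) (funext fun j => inv_mul_cancel₀ (hr j).ne')

theorem multiFactorial_pos (α : Fin d → ℕ) : (0 : ℝ) < multiFactorial α :=
  Nat.cast_pos.2 (Finset.prod_pos fun j _ => (α j).factorial_pos)

theorem one_le_multiFactorial (α : Fin d → ℕ) : (1 : ℝ) ≤ multiFactorial α :=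
  Nat.one_le_cast.2 (Finset.prod_pos fun j _ => (α j).factorial_pos)

theorem multiFactorial_rpow (α : Fin d → ℕ) (p : ℝ) :
    (multiFactorial α : ℝ) ^ p = ∏ j, ((α j).factorial : ℝ) ^ p := by
  rw [Real.finsetProd_rpow _ _ fun j _ => Nat.cast_nonneg _, multiFactorial, Nat.cast_prod]

theorem sqrt_multiFactorial (α : Fin d → ℕ) :
    √(multiFactorial α : ℝ) = ∏ j, √((α j).factorial : ℝ) := by
  simp only [Real.sqrt_eq_rpow, multiFactorial_rpow]

theorem sqrt_multiFactorial_pos (α : Fin d → ℕ) : 0 < √(multiFactorial α : ℝ) :=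
  Real.sqrt_pos.2 (multiFactorial_pos α)

theorem multiFactorial_le_add (α β : Fin d → ℕ) :
    (multiFactorial α : ℝ) ≤ multiFactorial (α + β) :=
  Nat.cast_le.2 (Finset.prod_le_prod' fun _ _ => Nat.factorial_le (Nat.le_add_right _ _))

theorem factorial_add_le_two_pow_mul (m n : ℕ) :
    (m + n).factorial ≤ 2 ^ (m + n) * (m.factorial * n.factorial) := by
  rw [← Nat.add_choose_mul_factorial_mul_factorial m n, mul_assoc]
  exact Nat.mul_le_mul_right _ (Nat.choose_le_two_pow _ _)

theorem multiFactorial_add_le (α β : Fin d → ℕ) :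
    (multiFactorial (α + β) : ℝ) ≤ mpow 2 (α + β) * (multiFactorial α * multiFactorial β) := by
  simp only [multiFactorial, mpow, Nat.cast_prod, ← Finset.prod_mul_distrib, Pi.add_apply,
    Pi.ofNat_apply]
  refine Finset.prod_le_prod (fun _ _ => Nat.cast_nonneg _) fun j _ => ?_
  exact_mod_cast factorial_add_le_two_pow_mul (α j) (β j)

theorem hasSum_mul_prod {ι κ 𝕜 : Type*} [RCLike 𝕜] {f : ι → 𝕜} {g : κ → 𝕜} {a b : 𝕜}
    (hf : HasSum f a) (hg : HasSum g b) :
    HasSum (fun p : ι × κ => f p.1 * g p.2) (a * b) :=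
  hf.mul hg (summable_mul_of_summable_norm hf.summable.norm hg.summable.norm)

theorem hasSum_pi_prod {𝕜 : Type*} [RCLike 𝕜] {f : Fin d → ℕ → 𝕜} {S : Fin d → 𝕜}
    (h : ∀ j, HasSum (f j) (S j)) :
    HasSum (fun α : Fin d → ℕ => ∏ j, f j (α j)) (∏ j, S j) := by
  induction d with
  | zero => simp
  | succ d ih =>
    have hprod := hasSum_mul_prod (h 0) (ih fun j => h j.succ)
    rw [Fin.prod_univ_succ, ← (Fin.consEquiv fun _ => ℕ).hasSum_iff]
    refine hprod.congr_fun fun p => ?_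
    simp [Fin.prod_univ_succ]

theorem summable_mpow_half : Summable (mpow (2⁻¹ : Fin d → ℝ)) := by
  have h : HasSum (fun n : ℕ => (2⁻¹ : ℝ) ^ n) 2 := by
    simpa only [one_div] using hasSum_geometric_two
  exact (hasSum_pi_prod fun _ => h).summable

theorem mpow_half_mul_mpow_two_mul (r : Fin d → ℝ) (α : Fin d → ℕ) :
    mpow 2⁻¹ α * mpow (2 * r) α = mpow r α := by
  rw [← mul_mpow, Pos.two.inv_mul_cancel]

section AdditiveConvolution

open Finset.HasAntidiagonal (antidiagonal mem_antidiagonal)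

instance : Finset.HasAntidiagonal (Fin d → ℕ) :=
  Finset.HasAntidiagonal.antidiagonalOfLocallyFinite

theorem hasSum_sum_antidiagonal {A E : Type*} [AddCommMonoid A] [Finset.HasAntidiagonal A]
    [AddCommMonoid E] [TopologicalSpace E] [ContinuousAdd E] [RegularSpace E]
    {F : A × A → E} {S : E} (h : HasSum F S) :
    HasSum (fun n => ∑ p ∈ antidiagonal n, F p) S := by
  refine (Finset.HasAntidiagonal.sigmaAntidiagonalEquivProd.hasSum_iff.2 h).sigma fun n => ?_
  rw [← Finset.sum_coe_sort (antidiagonal n) F]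
  exact hasSum_fintype _

theorem card_antidiagonal_le (α : Fin d → ℕ) : ((antidiagonal α).card : ℝ) ≤ mpow 2 α := by
  have hfst : (antidiagonal α).card ≤ (Finset.Iic α).card := by
    refine Finset.card_le_card_of_injOn Prod.fst (fun p hp => ?_) fun p hp q hq h => ?_
    · exact Finset.mem_coe.2 (Finset.mem_Iic.2 (mem_antidiagonal.1 hp ▸ le_self_add))
    · have hpq : p.1 + p.2 = p.1 + q.2 :=
        (mem_antidiagonal.1 hp).trans (h ▸ (mem_antidiagonal.1 hq).symm)
      exact Prod.ext h (add_left_cancel hpq)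
  have hIic : (Finset.Iic α).card ≤ ∏ j, 2 ^ α j := by
    rw [Pi.card_Iic]
    refine Finset.prod_le_prod' fun j _ => ?_
    rw [Nat.card_Iic]
    exact Nat.lt_two_pow_self
  simp only [mpow, Pi.ofNat_apply]
  exact_mod_cast hfst.trans hIic

/-- The coefficients of the product of the power series with coefficients `a` and `b`. -/
def cauchyProd (a b : (Fin d → ℕ) → ℂ) (α : Fin d → ℕ) : ℂ :=
  ∑ p ∈ antidiagonal α, a p.1 * b p.2

theorem hasSum_cauchyProd {a b : (Fin d → ℕ) → ℂ} {z : Fin d → ℂ} {A B : ℂ}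
    (ha : HasSum (fun α => a α * mpow z α) A) (hb : HasSum (fun α => b α * mpow z α) B) :
    HasSum (fun α => cauchyProd a b α * mpow z α) (A * B) := by
  have hprod := hasSum_sum_antidiagonal (hasSum_mul_prod ha hb)
  refine hprod.congr_fun fun α => ?_
  rw [cauchyProd, Finset.sum_mul]
  refine Finset.sum_congr rfl fun p hp => ?_
  rw [← mem_antidiagonal.1 hp, mpow_add]
  ring

/-- The correlation `(e ⋆ v)(β) = ∑ δ, e(δ) v(β + δ)` of two families of coefficients, which is the
transpose of the Cauchy product with `e`. -/
def correlation (e v : (Fin d → ℕ) → ℂ) (β : Fin d → ℕ) : ℂ := ∑' δ, e δ * v (β + δ)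

theorem correlation_correlation {e e' v : (Fin d → ℕ) → ℂ}
    (hsum : ∀ β, Summable fun p : (Fin d → ℕ) × (Fin d → ℕ) => e p.1 * e' p.2 * v (β + p.1 + p.2)) :
    correlation e (correlation e' v) = correlation (cauchyProd e e') v := by
  ext β
  have hantidiagonal := hasSum_sum_antidiagonal (hsum β).hasSum
  calc correlation e (correlation e' v) β
      = ∑' p : (Fin d → ℕ) × (Fin d → ℕ), e p.1 * e' p.2 * v (β + p.1 + p.2) := by
        rw [(hsum β).tsum_prod]
        simp only [correlation, mul_assoc, tsum_mul_left]
    _ = correlation (cauchyProd e e') v β := by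
        rw [← hantidiagonal.tsum_eq]
        refine tsum_congr fun α => ?_
        rw [cauchyProd, Finset.sum_mul]
        refine Finset.sum_congr rfl fun p hp => ?_
        rw [add_assoc, mem_antidiagonal.1 hp]

end AdditiveConvolution

section PowerSeries

/-- The power series `∑ a(α) z^α` converges on all of `ℂᵈ` to the entire function `A`. In contrast
to `IsSum`, the monomials are not normalized. -/
def HasTaylorSeries (a : (Fin d → ℕ) → ℂ) (A : (Fin d → ℂ) → ℂ) : Prop :=
  ∀ z, HasSum (fun α => a α * mpow z α) (A z)

variable {a b : (Fin d → ℕ) → ℂ} {A B : (Fin d → ℂ) → ℂ}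

theorem HasTaylorSeries.mul (hA : HasTaylorSeries a A) (hB : HasTaylorSeries b B) :
    HasTaylorSeries (cauchyProd a b) (A * B) := fun z => hasSum_cauchyProd (hA z) (hB z)

theorem HasTaylorSeries.measurable (hA : HasTaylorSeries a A) : Measurable A :=
  measurable_of_tendsto_metrizable' Filter.atTop
    (fun s => Finset.measurable_sum s fun α _ => ((continuous_mpow α).measurable.const_mul (a α)))
    (tendsto_pi_nhds.2 hA)

theorem HasTaylorSeries.summable_norm (hA : HasTaylorSeries a A) {t : Fin d → ℝ} (ht : 0 ≤ t) :
    Summable fun α => ‖a α‖ * mpow t α := by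
  refine (hA fun j => (t j : ℂ)).summable.norm.congr fun α => ?_
  rw [norm_mul, norm_mpow]
  simp only [Complex.norm_real, Real.norm_eq_abs, abs_of_nonneg (ht _)]

theorem HasTaylorSeries.norm_le (hA : HasTaylorSeries a A) {t : Fin d → ℝ} (ht : 0 ≤ t)
    {z : Fin d → ℂ} (hz : ∀ j, ‖z j‖ ≤ t j) : ‖A z‖ ≤ ∑' α, ‖a α‖ * mpow t α := by
  rw [← (hA z).tsum_eq]
  refine tsum_of_norm_bounded (hA.summable_norm ht).hasSum fun α => ?_
  rw [norm_mul]
  exact mul_le_mul_of_nonneg_left (norm_mpow_le hz α) (norm_nonneg _)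

theorem hasTaylorSeries_of_summable (h : ∀ t, Pos t → Summable fun α => ‖a α‖ * mpow t α) :
    HasTaylorSeries a fun z => ∑' α, a α * mpow z α := fun z => by
  refine (Summable.of_norm_bounded (h (fun j => ‖z j‖ + 1) fun j => by positivity)
    fun α => ?_).hasSum
  rw [norm_mul]
  exact mul_le_mul_of_nonneg_left (norm_mpow_le (fun j => (lt_add_one _).le) α) (norm_nonneg _)

end PowerSeries

section Quadratic

/-- The Taylor coefficients of `t ↦ e^{ε t²}`. -/
def quadCoeffOne (ε : ℂ) (n : ℕ) : ℂ := if Even n then ε ^ (n / 2) / (n / 2).factorial else 0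

/-- The Taylor coefficients of `z ↦ e^{ε(z₁² + ⋯ + z_d²)}`. -/
def quadCoeff (ε : ℂ) (α : Fin d → ℕ) : ℂ := ∏ j, quadCoeffOne ε (α j)

theorem hasSum_quadCoeffOne (ε t : ℂ) :
    HasSum (fun n => quadCoeffOne ε n * t ^ n) (Complex.exp (ε * t ^ 2)) := by
  have hinj : Function.Injective fun k : ℕ => 2 * k := fun a b h => by simpa using h
  rw [← hinj.hasSum_iff]
  · have h := NormedSpace.expSeries_div_hasSum_exp (ε * t ^ 2)
    rw [← Complex.exp_eq_exp_ℂ] at h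
    refine h.congr_fun fun k => ?_
    simp only [quadCoeffOne, Function.comp_apply, even_two_mul, if_true, mul_pow, pow_mul,
      Nat.mul_div_cancel_left k two_pos]
    ring
  · intro n hn
    have hodd : ¬ Even n := fun ⟨k, hk⟩ => hn ⟨k, by simp [hk, two_mul]⟩
    rw [quadCoeffOne, if_neg hodd, zero_mul]

theorem hasTaylorSeries_quadCoeff (ε : ℂ) :
    HasTaylorSeries (quadCoeff ε) fun z : Fin d → ℂ => Complex.exp (ε * ∑ j, z j ^ 2) := by
  intro z
  have h := hasSum_pi_prod fun j => hasSum_quadCoeffOne ε (z j)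
  simpa only [Finset.prod_mul_distrib, Finset.mul_sum, Complex.exp_sum, quadCoeff, mpow] using h

theorem quadCoeff_zero : quadCoeff (0 : ℂ) = (Pi.single 0 1 : (Fin d → ℕ) → ℂ) := by
  have hone : quadCoeffOne 0 = Pi.single 0 1 := by
    ext n
    rcases eq_or_ne n 0 with rfl | hn
    · simp [quadCoeffOne]
    · rw [quadCoeffOne, Pi.single_eq_of_ne hn]
      split_ifs with heven
      · obtain ⟨k, rfl⟩ := heven
        rw [zero_pow (by omega), zero_div]
      · rfl
  ext α
  rw [quadCoeff, hone]
  rcases eq_or_ne α 0 with rfl | hα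
  · simp
  · obtain ⟨j, hj⟩ := Function.ne_iff.1 hα
    rw [Pi.single_eq_of_ne hα]
    exact Finset.prod_eq_zero (Finset.mem_univ j) (Pi.single_eq_of_ne hj _)

theorem cauchyProd_single_zero (a : (Fin d → ℕ) → ℂ) : cauchyProd a (Pi.single 0 1) = a := by
  ext α
  rw [cauchyProd, Finset.sum_eq_single (α, 0)]
  · rw [Pi.single_eq_same, mul_one]
  · intro p hp hne
    rw [Pi.single_eq_of_ne, mul_zero]
    rintro h
    refine hne (Prod.ext ?_ h)
    rw [← Finset.HasAntidiagonal.mem_antidiagonal.1 hp, h, add_zero]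
  · exact fun h => (h (Finset.HasAntidiagonal.mem_antidiagonal.2 (add_zero α))).elim

theorem correlation_single_zero (v : (Fin d → ℕ) → ℂ) : correlation (Pi.single 0 1) v = v := by
  ext β
  rw [correlation, tsum_eq_single 0 fun δ hδ => by rw [Pi.single_eq_of_ne hδ, zero_mul],
    Pi.single_eq_same, one_mul, add_zero]

end Quadratic

section FactorialWeight

/-- The weight `r^α α!^{-κ}`. -/
def factorialWeight (κ : ℝ) (r : Fin d → ℝ) (α : Fin d → ℕ) : ℝ :=
  mpow r α * (multiFactorial α : ℝ) ^ (-κ)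

variable {κ μ : ℝ} {r R : Fin d → ℝ}

theorem factorialWeight_pos (κ : ℝ) (hr : Pos r) (α : Fin d → ℕ) : 0 < factorialWeight κ r α :=
  mul_pos (hr.mpow α) (Real.rpow_pos_of_pos (multiFactorial_pos α) _)

theorem factorialWeight_zero (r : Fin d → ℝ) : factorialWeight 0 r = mpow r := by
  ext α
  rw [factorialWeight, neg_zero, Real.rpow_zero, mul_one]

theorem factorialWeight_mul_factorialWeight (μ κ : ℝ) (R r : Fin d → ℝ) :
    factorialWeight μ R * factorialWeight κ r = factorialWeight (μ + κ) (R * r) := by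
  ext α
  rw [Pi.mul_apply, factorialWeight, factorialWeight, factorialWeight, mul_mpow, neg_add,
    Real.rpow_add (multiFactorial_pos α)]
  ring

theorem factorialWeight_mono (κ : ℝ) (hr : 0 ≤ r) (h : r ≤ R) (α : Fin d → ℕ) :
    factorialWeight κ r α ≤ factorialWeight κ R α :=
  mul_le_mul_of_nonneg_right (mpow_le_mpow_left hr h α)
    (Real.rpow_nonneg (multiFactorial_pos α).le _)

theorem factorialWeight_anti (h : κ ≤ μ) (hr : 0 ≤ r) (α : Fin d → ℕ) :
    factorialWeight μ r α ≤ factorialWeight κ r α :=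
  mul_le_mul_of_nonneg_left
    (Real.rpow_le_rpow_of_exponent_le (one_le_multiFactorial α) (neg_le_neg h)) (mpow_nonneg hr α)

theorem pow_mul_factorial_rpow_le {x : ℝ} (hκ : 0 < κ) (hx : 0 ≤ x) (n : ℕ) :
    x ^ n * (n.factorial : ℝ) ^ (-κ) ≤ Real.exp (κ * x ^ κ⁻¹) := by
  have hfac : (0 : ℝ) < n.factorial := Nat.cast_pos.2 n.factorial_pos
  calc x ^ n * (n.factorial : ℝ) ^ (-κ) = ((x ^ κ⁻¹) ^ n / n.factorial) ^ κ := by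
        rw [Real.div_rpow (by positivity) hfac.le, ← Real.rpow_mul_natCast hx, mul_comm κ⁻¹,
          Real.rpow_natCast_mul hx, Real.rpow_inv_rpow (pow_nonneg hx n) hκ.ne',
          Real.rpow_neg hfac.le, div_eq_mul_inv]
    _ ≤ Real.exp (x ^ κ⁻¹) ^ κ :=
        Real.rpow_le_rpow (by positivity)
          (Real.pow_div_factorial_le_exp _ (Real.rpow_nonneg hx _) n) hκ.le
    _ = Real.exp (κ * x ^ κ⁻¹) := by rw [← Real.exp_mul, mul_comm]

theorem exists_factorialWeight_le (hκ : 0 < κ) (hr : 0 ≤ r) :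
    ∃ C, ∀ α, factorialWeight κ r α ≤ C := by
  refine ⟨∏ j, Real.exp (κ * r j ^ κ⁻¹), fun α => ?_⟩
  rw [factorialWeight, multiFactorial_rpow, mpow, ← Finset.prod_mul_distrib]
  exact Finset.prod_le_prod
    (fun j _ => mul_nonneg (pow_nonneg (hr j) _) (Real.rpow_nonneg (Nat.cast_nonneg _) _))
    fun j _ => pow_mul_factorial_rpow_le hκ (hr j) _

theorem exists_factorialWeight_le_mul (hκ : κ < μ) (hR : Pos R) (hr : Pos r) :
    ∃ C, ∀ α, factorialWeight μ R α ≤ C * factorialWeight κ r α := by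
  obtain ⟨C, hC⟩ := exists_factorialWeight_le (sub_pos.2 hκ) (hr.inv.mul hR).nonneg
  refine ⟨C, fun α => ?_⟩
  have hsplit := congrFun (factorialWeight_mul_factorialWeight (μ - κ) κ (r⁻¹ * R) r) α
  rw [sub_add_cancel, mul_comm _ r, hr.mul_inv_cancel] at hsplit
  rw [← hsplit]
  exact mul_le_mul_of_nonneg_right (hC α) (factorialWeight_pos κ hr α).le

theorem factorialWeight_add_le (hκ : 0 ≤ κ) (hr : 0 ≤ r) (α β : Fin d → ℕ) :
    factorialWeight κ r (α + β) ≤ factorialWeight κ r α * mpow r β := by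
  rw [factorialWeight, factorialWeight, mpow_add, mul_right_comm]
  exact mul_le_mul_of_nonneg_right (mul_le_mul_of_nonneg_left
    (Real.rpow_le_rpow_of_nonpos (multiFactorial_pos α) (multiFactorial_le_add α β)
      (neg_nonpos.2 hκ)) (mpow_nonneg hr α)) (mpow_nonneg hr β)

theorem multiFactorial_add_rpow_le (hκ : 0 ≤ κ) (hκ1 : κ ≤ 1) (α β : Fin d → ℕ) :
    (multiFactorial (α + β) : ℝ) ^ κ ≤
      mpow 2 (α + β) * ((multiFactorial α : ℝ) ^ κ * (multiFactorial β : ℝ) ^ κ) := by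
  have hα := (multiFactorial_pos α).le
  have hβ := (multiFactorial_pos β).le
  have htwo : (1 : ℝ) ≤ mpow 2 (α + β) := one_le_mpow (fun _ => one_le_two) (α + β)
  calc (multiFactorial (α + β) : ℝ) ^ κ
      ≤ (mpow 2 (α + β) * (multiFactorial α * multiFactorial β)) ^ κ :=
        Real.rpow_le_rpow (multiFactorial_pos _).le (multiFactorial_add_le α β) hκ
    _ = mpow 2 (α + β) ^ κ * ((multiFactorial α : ℝ) ^ κ * (multiFactorial β : ℝ) ^ κ) := by
        rw [Real.mul_rpow (zero_le_one.trans htwo) (mul_nonneg hα hβ), Real.mul_rpow hα hβ]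
    _ ≤ mpow 2 (α + β) * ((multiFactorial α : ℝ) ^ κ * (multiFactorial β : ℝ) ^ κ) :=
        mul_le_mul_of_nonneg_right (Real.rpow_le_self_of_one_le htwo hκ1)
          (mul_nonneg (Real.rpow_nonneg hα _) (Real.rpow_nonneg hβ _))

theorem factorialWeight_mul_le_add (hκ : 0 ≤ κ) (hκ1 : κ ≤ 1) (hr : 0 ≤ r) (α β : Fin d → ℕ) :
    factorialWeight κ r α * factorialWeight κ r β ≤ factorialWeight κ (2 * r) (α + β) := by
  have hα := Real.rpow_pos_of_pos (multiFactorial_pos α) κ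
  have hβ := Real.rpow_pos_of_pos (multiFactorial_pos β) κ
  have hαβ := Real.rpow_pos_of_pos (multiFactorial_pos (α + β)) κ
  have hfac : ((multiFactorial α : ℝ) ^ κ * (multiFactorial β : ℝ) ^ κ)⁻¹ ≤
      mpow 2 (α + β) * ((multiFactorial (α + β) : ℝ) ^ κ)⁻¹ := by
    rw [inv_le_iff_one_le_mul₀ (mul_pos hα hβ), mul_right_comm, ← div_eq_mul_inv, one_le_div hαβ]
    exact multiFactorial_add_rpow_le hκ hκ1 α β
  simp only [factorialWeight, Real.rpow_neg (multiFactorial_pos _).le]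
  calc mpow r α * ((multiFactorial α : ℝ) ^ κ)⁻¹ * (mpow r β * ((multiFactorial β : ℝ) ^ κ)⁻¹)
      = mpow r (α + β) * ((multiFactorial α : ℝ) ^ κ * (multiFactorial β : ℝ) ^ κ)⁻¹ := by
        rw [mpow_add, mul_inv]
        ring
    _ ≤ mpow r (α + β) * (mpow 2 (α + β) * ((multiFactorial (α + β) : ℝ) ^ κ)⁻¹) :=
        mul_le_mul_of_nonneg_left hfac (mpow_nonneg hr _)
    _ = mpow (2 * r) (α + β) * ((multiFactorial (α + β) : ℝ) ^ κ)⁻¹ := by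
        rw [mul_mpow]
        ring

end FactorialWeight

section Domination

variable {v : (Fin d → ℕ) → ℂ} {m u w w' : (Fin d → ℕ) → ℝ}

theorem DominatedBy.trans (hv : DominatedBy v w) (hw : 0 ≤ w) {K : ℝ}
    (h : ∀ α, w α ≤ K * w' α) : DominatedBy v w' := by
  obtain ⟨C, hC⟩ := hv
  refine ⟨max C 0 * K, fun α => ?_⟩
  calc ‖v α‖ ≤ max C 0 * w α := (hC α).trans (mul_le_mul_of_nonneg_right (le_max_left _ _) (hw α))
    _ ≤ max C 0 * (K * w' α) := mul_le_mul_of_nonneg_left (h α) (le_max_right _ _)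
    _ = max C 0 * K * w' α := (mul_assoc _ _ _).symm

theorem DominatedBy.smul (hv : DominatedBy v w) {K : ℝ} (hm : ∀ α, |m α| ≤ K * u α) :
    DominatedBy (m • v) (u * w) := by
  obtain ⟨C, hC⟩ := hv
  refine ⟨K * C, fun α => ?_⟩
  calc ‖(m • v) α‖ = |m α| * ‖v α‖ := by rw [Pi.smul_apply', norm_smul, Real.norm_eq_abs]
    _ ≤ K * u α * (C * w α) :=
        mul_le_mul (hm α) (hC α) (norm_nonneg _) ((abs_nonneg _).trans (hm α))
    _ = K * C * (u * w) α := by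
        rw [Pi.mul_apply]
        ring

/-- The families of coefficients dominated by some weight `w r`: the Roumieu type condition. -/
def roumieuClass (w : (Fin d → ℝ) → (Fin d → ℕ) → ℝ) : Set ((Fin d → ℕ) → ℂ) :=
  {v | ∃ r, Pos r ∧ DominatedBy v (w r)}

/-- The families of coefficients dominated by every weight `w r`: the Beurling type condition. -/
def beurlingClass (w : (Fin d → ℝ) → (Fin d → ℕ) → ℝ) : Set ((Fin d → ℕ) → ℂ) :=
  {v | ∀ r, Pos r → DominatedBy v (w r)}

end Domination

section Multipliers

variable {m : (Fin d → ℕ) → ℝ} {v : (Fin d → ℕ) → ℂ}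
  {w w' : (Fin d → ℝ) → (Fin d → ℕ) → ℝ} {κ μ p : ℝ}

/-- Multiplication by `m` maps `w r`-dominated families to `w' (ρr)`-dominated ones, where `ρ` does
not depend on `r`. This makes `m` act both on Roumieu and on Beurling classes. -/
def IsMultiplier (m : (Fin d → ℕ) → ℝ) (w w' : (Fin d → ℝ) → (Fin d → ℕ) → ℝ) : Prop :=
  ∃ ρ, Pos ρ ∧ ∀ r, Pos r → ∀ v, DominatedBy v (w r) → DominatedBy (m • v) (w' (ρ * r))

theorem IsMultiplier.smul_mem_roumieuClass (hm : IsMultiplier m w w') (hv : v ∈ roumieuClass w) :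
    m • v ∈ roumieuClass w' := by
  obtain ⟨ρ, hρ, h⟩ := hm
  obtain ⟨r, hr, hvr⟩ := hv
  exact ⟨ρ * r, hρ.mul hr, h r hr v hvr⟩

theorem IsMultiplier.smul_mem_beurlingClass (hm : IsMultiplier m w w') (hv : v ∈ beurlingClass w) :
    m • v ∈ beurlingClass w' := by
  obtain ⟨ρ, hρ, h⟩ := hm
  intro r hr
  have hr' := hρ.inv.mul hr
  simpa only [hρ.mul_inv_cancel] using h _ hr' v (hv _ hr')

/-- Multiplication by the nowhere vanishing sequence `m` is an isomorphism between the classes of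
`w` and those of `w'`. -/
structure IsScaling (m : (Fin d → ℕ) → ℝ) (w w' : (Fin d → ℝ) → (Fin d → ℕ) → ℝ) : Prop where
  ne_zero : ∀ α, m α ≠ 0
  isMultiplier : IsMultiplier m w w'
  isMultiplier_inv : IsMultiplier m⁻¹ w' w

theorem inv_smul_smul_of_ne_zero (hm : ∀ α, m α ≠ 0) (v : (Fin d → ℕ) → ℂ) : m⁻¹ • m • v = v :=
  funext fun α => inv_smul_smul₀ (hm α) (v α)

theorem smul_inv_smul_of_ne_zero (hm : ∀ α, m α ≠ 0) (v : (Fin d → ℕ) → ℂ) : m • m⁻¹ • v = v :=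
  funext fun α => smul_inv_smul₀ (hm α) (v α)

theorem IsScaling.smul_mem_roumieuClass_iff (hm : IsScaling m w w') :
    m • v ∈ roumieuClass w' ↔ v ∈ roumieuClass w := by
  refine ⟨fun h => ?_, hm.isMultiplier.smul_mem_roumieuClass⟩
  simpa only [inv_smul_smul_of_ne_zero hm.ne_zero] using
    hm.isMultiplier_inv.smul_mem_roumieuClass h

theorem IsScaling.smul_mem_beurlingClass_iff (hm : IsScaling m w w') :
    m • v ∈ beurlingClass w' ↔ v ∈ beurlingClass w := by
  refine ⟨fun h => ?_, hm.isMultiplier.smul_mem_beurlingClass⟩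
  simpa only [inv_smul_smul_of_ne_zero hm.ne_zero] using
    hm.isMultiplier_inv.smul_mem_beurlingClass h

/-- `|m(α)| ≲ R^α α!^{-μ}` for some `R`. For `μ = 0` this is geometric growth. -/
def HasFactorialDecay (μ : ℝ) (m : (Fin d → ℕ) → ℝ) : Prop :=
  ∃ R, Pos R ∧ ∃ C, ∀ α, |m α| ≤ C * factorialWeight μ R α

theorem HasFactorialDecay.isMultiplier (hm : HasFactorialDecay μ m) (κ : ℝ) :
    IsMultiplier m (factorialWeight κ) (factorialWeight (μ + κ)) := by
  obtain ⟨R, hR, C, hC⟩ := hm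
  refine ⟨R, hR, fun r _ v hv => ?_⟩
  rw [← factorialWeight_mul_factorialWeight]
  exact hv.smul hC

theorem HasFactorialDecay.isScaling (hm₀ : ∀ α, m α ≠ 0) (hm : HasFactorialDecay μ m)
    (hm' : HasFactorialDecay (-μ) m⁻¹) (κ : ℝ) :
    IsScaling m (factorialWeight κ) (factorialWeight (μ + κ)) where
  ne_zero := hm₀
  isMultiplier := hm.isMultiplier κ
  isMultiplier_inv := by
    simpa only [neg_add_cancel_left] using hm'.isMultiplier (μ + κ)

theorem inv_factorialWeight (μ : ℝ) (R : Fin d → ℝ) :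
    (factorialWeight μ R)⁻¹ = factorialWeight (-μ) R⁻¹ := by
  ext α
  simp only [Pi.inv_apply, factorialWeight, mpow, mul_inv, inv_pow, Finset.prod_inv_distrib,
    Real.rpow_neg (Nat.cast_nonneg _) (-μ)]

theorem hasFactorialDecay_factorialWeight (μ : ℝ) {R : Fin d → ℝ} (hR : Pos R) :
    HasFactorialDecay μ (factorialWeight μ R) :=
  ⟨R, hR, 1, fun α => by rw [abs_of_pos (factorialWeight_pos μ hR α), one_mul]⟩

theorem hasFactorialDecay_inv_factorialWeight (μ : ℝ) {R : Fin d → ℝ} (hR : Pos R) :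
    HasFactorialDecay (-μ) (factorialWeight μ R)⁻¹ :=
  inv_factorialWeight μ R ▸ hasFactorialDecay_factorialWeight (-μ) hR.inv

theorem isScaling_factorialWeight (μ κ : ℝ) {R : Fin d → ℝ} (hR : Pos R) :
    IsScaling (factorialWeight μ R) (factorialWeight κ) (factorialWeight (μ + κ)) :=
  (hasFactorialDecay_factorialWeight μ hR).isScaling (fun α => (factorialWeight_pos μ hR α).ne')
    (hasFactorialDecay_inv_factorialWeight μ hR) κ

end Multipliers

section ExponentialWeight

variable {p c R : ℝ}

/-- The weight `e^{-∑ α_j^p / r_j}`. -/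
def expWeight (p : ℝ) (r : Fin d → ℝ) (α : Fin d → ℕ) : ℝ :=
  Real.exp (-∑ j, (1 / r j) * (α j : ℝ) ^ p)

theorem expWeight_nonneg (p : ℝ) (r : Fin d → ℝ) : 0 ≤ expWeight p r := fun _ => (Real.exp_pos _).le

theorem expWeight_le_one {r : Fin d → ℝ} (hr : Pos r) (α : Fin d → ℕ) : expWeight p r α ≤ 1 :=
  Real.exp_le_one_iff.2 (neg_nonpos.2 (Finset.sum_nonneg fun j _ =>
    mul_nonneg (one_div_nonneg.2 (hr j).le) (Real.rpow_nonneg (Nat.cast_nonneg _) _)))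

theorem expWeight_two_mul_mul_self (p : ℝ) (r : Fin d → ℝ) :
    expWeight p (2 * r) * expWeight p (2 * r) = expWeight p r := by
  ext α
  simp only [Pi.mul_apply, expWeight, ← Real.exp_add, ← neg_add, ← Finset.sum_add_distrib,
    Pi.ofNat_apply, ← add_mul]
  congr! 4 with j
  rw [← add_div, one_add_one_eq_two, div_mul_cancel_left₀ two_ne_zero, one_div]

theorem log_mul_le_rpow_eventually (hp : 1 < p) (hc : 0 < c) (hR : 0 < R) :
    ∀ᶠ n : ℕ in Filter.atTop, Real.log (R * n) ≤ c * (n : ℝ) ^ (p - 1) := by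
  have hRn : Filter.Tendsto (fun n : ℕ => R * (n : ℝ)) Filter.atTop Filter.atTop :=
    tendsto_natCast_atTop_atTop.const_mul_atTop hR
  have hlog := hRn.eventually ((isLittleO_log_rpow_atTop (sub_pos.2 hp)).def
    (c := c / R ^ (p - 1)) (div_pos hc (Real.rpow_pos_of_pos hR _)))
  filter_upwards [hlog] with n hn
  refine (Real.le_norm_self _).trans (hn.trans_eq ?_)
  rw [Real.norm_of_nonneg (by positivity), Real.mul_rpow hR.le n.cast_nonneg, ← mul_assoc,
    div_mul_cancel₀ _ (Real.rpow_pos_of_pos hR _).ne']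

theorem pow_mul_factorial_le_exp_eventually (hp : 1 < p) (hc : 0 < c) (hR : 0 < R) :
    ∀ᶠ n : ℕ in Filter.atTop, R ^ n * n.factorial ≤ Real.exp (c * (n : ℝ) ^ p) := by
  filter_upwards [log_mul_le_rpow_eventually hp hc hR, Filter.eventually_gt_atTop 0] with n hlog hn
  have hn : (0 : ℝ) < n := Nat.cast_pos.2 hn
  calc R ^ n * (n.factorial : ℝ) ≤ R ^ n * (n : ℝ) ^ n := by
        gcongr
        exact_mod_cast n.factorial_le_pow
    _ = Real.exp (n * Real.log (R * n)) := by
        rw [← mul_pow, Real.exp_nat_mul, Real.exp_log (mul_pos hR hn)]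
    _ ≤ Real.exp (n * (c * (n : ℝ) ^ (p - 1))) := by gcongr
    _ = Real.exp (c * (n : ℝ) ^ p) := by
        rw [mul_left_comm, Real.rpow_sub_one hn.ne', mul_div_cancel₀ _ hn.ne']

theorem exists_pow_mul_factorial_le_exp (hp : 1 < p) (hc : 0 < c) (hR : 0 < R) :
    ∃ C, ∀ n : ℕ, R ^ n * n.factorial ≤ C * Real.exp (c * (n : ℝ) ^ p) := by
  have hev : ∀ᶠ n : ℕ in Filter.atTop,
      R ^ n * n.factorial / Real.exp (c * (n : ℝ) ^ p) ≤ 1 := by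
    filter_upwards [pow_mul_factorial_le_exp_eventually hp hc hR] with n hn
    exact div_le_one_of_le₀ hn (Real.exp_pos _).le
  obtain ⟨C, hC⟩ := (Filter.isBoundedUnder_of_eventually_le hev).bddAbove_range
  exact ⟨C, fun n => (div_le_iff₀ (Real.exp_pos _)).1 (hC ⟨n, rfl⟩)⟩

theorem exists_factorialWeight_mul_expWeight_le (hp : 1 < p) {μ : ℝ} (hμ : -1 ≤ μ)
    {r R : Fin d → ℝ} (hr : Pos r) (hR : Pos R) :
    ∃ C, ∀ α, (factorialWeight μ R * expWeight p r) α ≤ C := by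
  choose C hC using fun j => exists_pow_mul_factorial_le_exp hp (one_div_pos.2 (hr j)) (hR j)
  refine ⟨∏ j, C j, fun α => ?_⟩
  rw [Pi.mul_apply, expWeight, Real.exp_neg, ← div_eq_mul_inv, div_le_iff₀ (Real.exp_pos _)]
  calc factorialWeight μ R α ≤ factorialWeight (-1) R α := factorialWeight_anti hμ hR.nonneg α
    _ = ∏ j, R j ^ α j * ((α j).factorial : ℝ) := by
        rw [factorialWeight, neg_neg, multiFactorial_rpow, mpow, ← Finset.prod_mul_distrib]
        simp only [Real.rpow_one]
    _ ≤ ∏ j, C j * Real.exp (1 / r j * (α j : ℝ) ^ p) :=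
        Finset.prod_le_prod (fun j _ => mul_nonneg (pow_nonneg (hR j).le _) (Nat.cast_nonneg _))
          fun j _ => hC j (α j)
    _ = (∏ j, C j) * Real.exp (∑ j, 1 / r j * (α j : ℝ) ^ p) := by
        rw [Finset.prod_mul_distrib, Real.exp_sum]

theorem HasFactorialDecay.isMultiplier_expWeight {μ : ℝ} {m : (Fin d → ℕ) → ℝ}
    (hm : HasFactorialDecay μ m) (hμ : -1 ≤ μ) (hp : 1 < p) :
    IsMultiplier m (expWeight p) (expWeight p) := by
  obtain ⟨R, hR, K, hK⟩ := hm
  refine ⟨2, Pos.two, fun r hr v hv => ?_⟩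
  obtain ⟨C, hC⟩ := exists_factorialWeight_mul_expWeight_le hp hμ (Pos.two.mul hr) hR
  refine (hv.smul hK).trans (mul_nonneg (fun α => (factorialWeight_pos μ hR α).le)
    (expWeight_nonneg p r)) (K := C) fun α => ?_
  rw [← expWeight_two_mul_mul_self p r, ← mul_assoc, Pi.mul_apply]
  exact mul_le_mul_of_nonneg_right (hC α) (expWeight_nonneg _ _ _)

theorem HasFactorialDecay.isScaling_expWeight {μ : ℝ} {m : (Fin d → ℕ) → ℝ} (hm₀ : ∀ α, m α ≠ 0)
    (hm : HasFactorialDecay μ m) (hm' : HasFactorialDecay (-μ) m⁻¹) (hμ : |μ| ≤ 1) (hp : 1 < p) :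
    IsScaling m (expWeight p) (expWeight p) where
  ne_zero := hm₀
  isMultiplier := hm.isMultiplier_expWeight (neg_le_of_abs_le hμ) hp
  isMultiplier_inv := hm'.isMultiplier_expWeight (neg_le_neg (le_of_abs_le hμ)) hp

theorem isScaling_factorialWeight_expWeight {μ : ℝ} (hμ : |μ| ≤ 1) (hp : 1 < p) {R : Fin d → ℝ}
    (hR : Pos R) : IsScaling (factorialWeight μ R) (expWeight p) (expWeight p) :=
  (hasFactorialDecay_factorialWeight μ hR).isScaling_expWeight
    (fun α => (factorialWeight_pos μ hR α).ne') (hasFactorialDecay_inv_factorialWeight μ hR) hμ hp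

end ExponentialWeight

section EntireClasses

/-- A class of Taylor coefficients consisting of bounded families, stable under multiplication by
sequences of geometric growth; the corresponding power series converge on all of `ℂᵈ`. -/
structure IsEntireClass (S : Set ((Fin d → ℕ) → ℂ)) : Prop where
  bounded : ∀ v ∈ S, ∃ C, ∀ α, ‖v α‖ ≤ C
  smul_mem : ∀ v ∈ S, ∀ m : (Fin d → ℕ) → ℝ, HasFactorialDecay 0 m → m • v ∈ S

variable {S : Set ((Fin d → ℕ) → ℂ)} {v : (Fin d → ℕ) → ℂ}
  {w : (Fin d → ℝ) → (Fin d → ℕ) → ℝ} {κ p : ℝ}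

theorem hasFactorialDecay_mpow {r : Fin d → ℝ} (hr : Pos r) : HasFactorialDecay 0 (mpow r) :=
  ⟨r, hr, 1, fun α => by rw [factorialWeight_zero, one_mul, abs_of_pos (hr.mpow α)]⟩

theorem IsEntireClass.summable_norm_mul_mpow (hS : IsEntireClass S) (hv : v ∈ S) {t : Fin d → ℝ}
    (ht : Pos t) : Summable fun α => ‖v α‖ * mpow t α := by
  obtain ⟨C, hC⟩ := hS.bounded _ (hS.smul_mem v hv _ (hasFactorialDecay_mpow (Pos.two.mul ht)))
  refine Summable.of_nonneg_of_le (fun α => mul_nonneg (norm_nonneg _) (ht.mpow α).le)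
    (fun α => ?_) (summable_mpow_half.mul_right C)
  have hα := hC α
  rw [Pi.smul_apply', norm_smul, Real.norm_of_nonneg ((Pos.two.mul ht).mpow α).le] at hα
  rw [← mpow_half_mul_mpow_two_mul t α, mul_left_comm, mul_comm ‖v α‖]
  exact mul_le_mul_of_nonneg_left hα (Pos.two.inv.mpow α).le

theorem IsEntireClass.exists_hasTaylorSeries (hS : IsEntireClass S) (hv : v ∈ S) :
    ∃ A, HasTaylorSeries v A :=
  ⟨_, hasTaylorSeries_of_summable fun _ ht => hS.summable_norm_mul_mpow hv ht⟩

/-- A family of bounded weights compatible with multiplication by sequences of geometric growth, so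
that both classes of families of coefficients it determines are entire. -/
structure IsEntireFamily (w : (Fin d → ℝ) → (Fin d → ℕ) → ℝ) : Prop where
  nonneg : ∀ r, Pos r → 0 ≤ w r
  bounded : ∀ r, Pos r → ∃ C, ∀ α, w r α ≤ C
  isMultiplier : ∀ m, HasFactorialDecay 0 m → IsMultiplier m w w

theorem IsEntireFamily.exists_norm_le (hw : IsEntireFamily w) {r : Fin d → ℝ} (hr : Pos r)
    (hv : DominatedBy v (w r)) : ∃ C, ∀ α, ‖v α‖ ≤ C := by
  obtain ⟨K, hK⟩ := hw.bounded r hr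
  obtain ⟨C, hC⟩ := hv.trans (w' := 1) (hw.nonneg r hr) fun α => by
    rw [Pi.one_apply, mul_one]
    exact hK α
  exact ⟨C, fun α => (hC α).trans_eq (mul_one C)⟩

theorem IsEntireFamily.isEntireClass_roumieuClass (hw : IsEntireFamily w) :
    IsEntireClass (roumieuClass w) where
  bounded := fun _ ⟨_, hr, hv⟩ => hw.exists_norm_le hr hv
  smul_mem := fun _ hv m hm => (hw.isMultiplier m hm).smul_mem_roumieuClass hv

theorem IsEntireFamily.isEntireClass_beurlingClass (hw : IsEntireFamily w) :
    IsEntireClass (beurlingClass w) where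
  bounded := fun _ hv => hw.exists_norm_le Pos.one (hv 1 Pos.one)
  smul_mem := fun _ hv m hm => (hw.isMultiplier m hm).smul_mem_beurlingClass hv

theorem isEntireFamily_factorialWeight (hκ : 0 < κ) :
    IsEntireFamily (factorialWeight κ : (Fin d → ℝ) → _) where
  nonneg := fun _ hr α => (factorialWeight_pos κ hr α).le
  bounded := fun _ hr => exists_factorialWeight_le hκ hr.nonneg
  isMultiplier := fun _ hm => by simpa only [zero_add] using hm.isMultiplier κ

theorem isEntireFamily_expWeight (hp : 1 < p) :
    IsEntireFamily (expWeight p : (Fin d → ℝ) → _) where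
  nonneg := fun r _ => expWeight_nonneg p r
  bounded := fun _ hr => ⟨1, expWeight_le_one hr⟩
  isMultiplier := fun _ hm => hm.isMultiplier_expWeight (by norm_num) hp

end EntireClasses

section GaussianClasses

open Finset.HasAntidiagonal (antidiagonal mem_antidiagonal)

/-- An entire class stable under multiplication of the power series by `e^{ε(z₁² + ⋯ + z_d²)}` and
under the transpose of this operation. -/
structure IsGaussianClass (S : Set ((Fin d → ℕ) → ℂ)) : Prop extends IsEntireClass S where
  cauchyProd_mem : ∀ v ∈ S, ∀ ε, cauchyProd v (quadCoeff ε) ∈ S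
  correlation_mem : ∀ v ∈ S, ∀ ε, correlation (quadCoeff ε) v ∈ S

variable {κ : ℝ} {r : Fin d → ℝ} {a b e v : (Fin d → ℕ) → ℂ}

theorem DominatedBy.cauchyProd (hκ : 0 ≤ κ) (hκ1 : κ ≤ 1) (hr : Pos r)
    (ha : DominatedBy a (factorialWeight κ r)) (hb : DominatedBy b (factorialWeight κ r)) :
    DominatedBy (cauchyProd a b) (factorialWeight κ (2 * (2 * r))) := by
  obtain ⟨K, hK⟩ := ha
  obtain ⟨L, hL⟩ := hb
  have hKnonneg : 0 ≤ K :=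
    nonneg_of_mul_nonneg_left ((norm_nonneg _).trans (hK 0)) (factorialWeight_pos κ hr 0)
  have hLnonneg : 0 ≤ L :=
    nonneg_of_mul_nonneg_left ((norm_nonneg _).trans (hL 0)) (factorialWeight_pos κ hr 0)
  have hterm : ∀ α, ∀ q ∈ antidiagonal α,
      ‖a q.1 * b q.2‖ ≤ K * L * factorialWeight κ (2 * r) α := fun α q hq => by
    calc ‖a q.1 * b q.2‖ ≤ K * factorialWeight κ r q.1 * (L * factorialWeight κ r q.2) := by
          rw [norm_mul]
          exact mul_le_mul (hK _) (hL _) (norm_nonneg _) ((norm_nonneg _).trans (hK _))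
      _ = K * L * (factorialWeight κ r q.1 * factorialWeight κ r q.2) := by ring
      _ ≤ K * L * factorialWeight κ (2 * r) α := by
          rw [← mem_antidiagonal.1 hq]
          exact mul_le_mul_of_nonneg_left (factorialWeight_mul_le_add hκ hκ1 hr.nonneg _ _)
            (mul_nonneg hKnonneg hLnonneg)
  refine ⟨K * L, fun α => ?_⟩
  have hweight := (factorialWeight_pos κ (Pos.two.mul hr) α).le
  have htwo := congrFun (factorialWeight_mul_factorialWeight 0 κ 2 (2 * r)) α
  rw [zero_add, Pi.mul_apply, factorialWeight_zero] at htwo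
  calc ‖Pilipovic.cauchyProd a b α‖
      ≤ (antidiagonal α).card • (K * L * factorialWeight κ (2 * r) α) :=
        (norm_sum_le _ _).trans (Finset.sum_le_card_nsmul _ _ _ (hterm α))
    _ ≤ mpow 2 α * (K * L * factorialWeight κ (2 * r) α) := by
        rw [nsmul_eq_mul]
        exact mul_le_mul_of_nonneg_right (card_antidiagonal_le α)
          (mul_nonneg (mul_nonneg hKnonneg hLnonneg) hweight)
    _ = K * L * factorialWeight κ (2 * (2 * r)) α := by
        rw [← htwo]
        ring

theorem DominatedBy.correlation (hκ : 0 ≤ κ) (hr : 0 ≤ r)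
    (he : Summable fun δ => ‖e δ‖ * mpow r δ) (hv : DominatedBy v (factorialWeight κ r)) :
    DominatedBy (correlation e v) (factorialWeight κ r) := by
  obtain ⟨K, hK⟩ := hv
  refine ⟨max K 0 * ∑' δ, ‖e δ‖ * mpow r δ, fun β => ?_⟩
  have hweight : ∀ α, 0 ≤ factorialWeight κ r α := fun α =>
    mul_nonneg (mpow_nonneg hr α) (Real.rpow_nonneg (multiFactorial_pos α).le _)
  rw [Pilipovic.correlation, mul_right_comm]
  refine tsum_of_norm_bounded (he.hasSum.mul_left _) fun δ => ?_
  calc ‖e δ * v (β + δ)‖ ≤ ‖e δ‖ * (max K 0 * factorialWeight κ r (β + δ)) := by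
        rw [norm_mul]
        gcongr
        exact (hK _).trans (mul_le_mul_of_nonneg_right (le_max_left K 0) (hweight _))
    _ ≤ ‖e δ‖ * (max K 0 * (factorialWeight κ r β * mpow r δ)) := by
        gcongr
        exact factorialWeight_add_le hκ hr β δ
    _ = max K 0 * factorialWeight κ r β * (‖e δ‖ * mpow r δ) := by ring

theorem norm_quadCoeffOne_le (ε : ℂ) (n : ℕ) :
    ‖quadCoeffOne ε n‖ ≤ (1 + 2 * ‖ε‖) ^ n * (n.factorial : ℝ) ^ (-(1 / 2) : ℝ) := by
  rw [quadCoeffOne]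
  split_ifs with heven
  · obtain ⟨k, rfl⟩ := heven
    have hfac : √((k + k).factorial : ℝ) ≤ 2 ^ k * k.factorial := by
      rw [Real.sqrt_le_left (by positivity), mul_pow, ← pow_mul, mul_two, sq (k.factorial : ℝ)]
      exact_mod_cast factorial_add_le_two_pow_mul k k
    have hpow : (2 * ‖ε‖) ^ k ≤ (1 + 2 * ‖ε‖) ^ (k + k) :=
      calc (2 * ‖ε‖) ^ k ≤ (1 + 2 * ‖ε‖) ^ k := by gcongr; linarith
        _ ≤ (1 + 2 * ‖ε‖) ^ (k + k) :=
            pow_le_pow_right₀ (le_add_of_nonneg_right (by positivity)) (Nat.le_add_right k k)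
    have hsqrt : 0 < √((k + k).factorial : ℝ) :=
      Real.sqrt_pos.2 (Nat.cast_pos.2 (k + k).factorial_pos)
    rw [Real.rpow_neg (Nat.cast_nonneg _), ← Real.sqrt_eq_rpow, norm_div, norm_pow,
      RCLike.norm_natCast, (by omega : (k + k) / 2 = k), ← div_eq_mul_inv,
      div_le_div_iff₀ (Nat.cast_pos.2 k.factorial_pos) hsqrt]
    calc ‖ε‖ ^ k * √((k + k).factorial : ℝ) ≤ ‖ε‖ ^ k * (2 ^ k * k.factorial) := by gcongr
      _ = (2 * ‖ε‖) ^ k * k.factorial := by ring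
      _ ≤ (1 + 2 * ‖ε‖) ^ (k + k) * k.factorial := by gcongr
  · rw [norm_zero]
    positivity

theorem dominatedBy_quadCoeff (ε : ℂ) :
    DominatedBy (quadCoeff ε) (factorialWeight (1 / 2) fun _ : Fin d => 1 + 2 * ‖ε‖) := by
  refine ⟨1, fun α => ?_⟩
  rw [one_mul, quadCoeff, norm_prod, factorialWeight, multiFactorial_rpow, mpow,
    ← Finset.prod_mul_distrib]
  exact Finset.prod_le_prod (fun _ _ => norm_nonneg _) fun _ _ => norm_quadCoeffOne_le ε _

theorem quadCoeff_mem_roumieuClass (hκ : κ ≤ 1 / 2) (ε : ℂ) :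
    (quadCoeff ε : (Fin d → ℕ) → ℂ) ∈ roumieuClass (factorialWeight κ) := by
  have hR : Pos fun _ : Fin d => 1 + 2 * ‖ε‖ := fun _ => by positivity
  refine ⟨_, hR, (dominatedBy_quadCoeff ε).trans (K := 1)
    (fun α => (factorialWeight_pos _ hR α).le) fun α => ?_⟩
  rw [one_mul]
  exact factorialWeight_anti hκ hR.nonneg α

theorem quadCoeff_mem_beurlingClass (hκ : κ < 1 / 2) (ε : ℂ) :
    (quadCoeff ε : (Fin d → ℕ) → ℂ) ∈ beurlingClass (factorialWeight κ) := by
  intro r hr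
  have hR : Pos fun _ : Fin d => 1 + 2 * ‖ε‖ := fun _ => by positivity
  obtain ⟨C, hC⟩ := exists_factorialWeight_le_mul hκ hR hr
  exact (dominatedBy_quadCoeff ε).trans (fun α => (factorialWeight_pos _ hR α).le) hC

theorem cauchyProd_mem_roumieuClass (hκ : 0 ≤ κ) (hκ1 : κ ≤ 1)
    (ha : a ∈ roumieuClass (factorialWeight κ)) (hb : b ∈ roumieuClass (factorialWeight κ)) :
    cauchyProd a b ∈ roumieuClass (factorialWeight κ) := by
  obtain ⟨r, hr, ha⟩ := ha
  obtain ⟨s, hs, hb⟩ := hb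
  have hrs : Pos (r ⊔ s) := fun j => lt_sup_of_lt_left (hr j)
  have ha' : DominatedBy a (factorialWeight κ (r ⊔ s)) :=
    ha.trans (K := 1) (fun α => (factorialWeight_pos κ hr α).le) fun α => by
      simpa only [one_mul] using factorialWeight_mono κ hr.nonneg le_sup_left α
  have hb' : DominatedBy b (factorialWeight κ (r ⊔ s)) :=
    hb.trans (K := 1) (fun α => (factorialWeight_pos κ hs α).le) fun α => by
      simpa only [one_mul] using factorialWeight_mono κ hs.nonneg le_sup_right α
  exact ⟨_, Pos.two.mul (Pos.two.mul hrs), ha'.cauchyProd hκ hκ1 hrs hb'⟩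

theorem cauchyProd_mem_beurlingClass (hκ : 0 ≤ κ) (hκ1 : κ ≤ 1)
    (ha : a ∈ beurlingClass (factorialWeight κ)) (hb : b ∈ beurlingClass (factorialWeight κ)) :
    cauchyProd a b ∈ beurlingClass (factorialWeight κ) := by
  intro r hr
  have hr' : Pos (2⁻¹ * (2⁻¹ * r)) := Pos.two.inv.mul (Pos.two.inv.mul hr)
  simpa only [Pos.two.mul_inv_cancel] using (ha _ hr').cauchyProd hκ hκ1 hr' (hb _ hr')

theorem isGaussianClass_roumieuClass (hκ : 0 < κ) (hκ2 : κ ≤ 1 / 2) :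
    IsGaussianClass (roumieuClass (factorialWeight κ : (Fin d → ℝ) → _)) where
  toIsEntireClass := (isEntireFamily_factorialWeight hκ).isEntireClass_roumieuClass
  cauchyProd_mem := fun _ hv ε =>
    cauchyProd_mem_roumieuClass hκ.le (by linarith) hv (quadCoeff_mem_roumieuClass hκ2 ε)
  correlation_mem := fun _ ⟨r, hr, hv⟩ ε =>
    ⟨r, hr, hv.correlation hκ.le hr.nonneg ((hasTaylorSeries_quadCoeff ε).summable_norm hr.nonneg)⟩

theorem isGaussianClass_beurlingClass (hκ : 0 < κ) (hκ2 : κ < 1 / 2) :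
    IsGaussianClass (beurlingClass (factorialWeight κ : (Fin d → ℝ) → _)) where
  toIsEntireClass := (isEntireFamily_factorialWeight hκ).isEntireClass_beurlingClass
  cauchyProd_mem := fun _ hv ε =>
    cauchyProd_mem_beurlingClass hκ.le (by linarith) hv (quadCoeff_mem_beurlingClass hκ2 ε)
  correlation_mem := fun _ hv ε r hr => (hv r hr).correlation hκ.le hr.nonneg
    ((hasTaylorSeries_quadCoeff ε).summable_norm hr.nonneg)

end GaussianClasses

section HermiteOne

/-- The derivatives of `z ↦ e^{-z²}` on `ℂ`: through them the Hermite functions, which are defined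
by real derivatives, become accessible to Cauchy's estimates. -/
def gaussianDeriv (n : ℕ) : ℂ → ℂ := iteratedDeriv n fun z => Complex.exp (-z ^ 2)

theorem differentiable_gaussianDeriv (n : ℕ) : Differentiable ℂ (gaussianDeriv n) := by
  have hexp : ContDiff ℂ (n + 1) fun z : ℂ => Complex.exp (-z ^ 2) := by fun_prop
  exact hexp.differentiable_iteratedDeriv n (by exact_mod_cast n.lt_succ_self)

theorem hasDerivAt_gaussianDeriv (n : ℕ) (t : ℝ) :
    HasDerivAt (fun u : ℝ => gaussianDeriv n u) (gaussianDeriv (n + 1) t) t := by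
  have h := (differentiable_gaussianDeriv n (t : ℂ)).hasDerivAt.comp_ofReal
  rwa [gaussianDeriv, ← iteratedDeriv_succ] at h

theorem ofReal_iteratedDeriv_exp_neg_sq (n : ℕ) (t : ℝ) :
    ((iteratedDeriv n (fun u : ℝ => Real.exp (-u ^ 2)) t : ℝ) : ℂ) = gaussianDeriv n t := by
  induction n generalizing t with
  | zero => simp [gaussianDeriv]
  | succ n ih =>
    have hexp : ContDiff ℝ (n + 1) fun u : ℝ => Real.exp (-u ^ 2) := by fun_prop
    have hderiv := hexp.differentiable_iteratedDeriv n (by exact_mod_cast n.lt_succ_self) t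
    rw [iteratedDeriv_succ]
    refine hderiv.hasDerivAt.ofReal_comp.unique ?_
    simpa only [ih] using hasDerivAt_gaussianDeriv n t

theorem re_neg_add_sq_le (t : ℝ) (u : ℂ) :
    (-(t + u) ^ 2).re ≤ -t ^ 2 + 2 * ‖u‖ * |t| + ‖u‖ ^ 2 := by
  have hexpand : (-(t + u) ^ 2).re = -t ^ 2 - 2 * (t * u.re) + (-u ^ 2).re := by
    simp only [pow_two, Complex.neg_re, Complex.mul_re, Complex.add_re, Complex.ofReal_re,
      Complex.add_im, Complex.ofReal_im, zero_add]
    ring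
  have hsq : (-u ^ 2).re ≤ ‖u‖ ^ 2 :=
    (Complex.re_le_norm _).trans_eq (by rw [norm_neg, norm_pow])
  have hcross : -(t * u.re) ≤ ‖u‖ * |t| :=
    calc -(t * u.re) ≤ |t * u.re| := neg_le_abs _
      _ = |u.re| * |t| := by rw [abs_mul, mul_comm]
      _ ≤ ‖u‖ * |t| := mul_le_mul_of_nonneg_right (Complex.abs_re_le_norm u) (abs_nonneg t)
  rw [hexpand]
  linarith

theorem norm_gaussianDeriv_le (n : ℕ) (t : ℝ) {ρ : ℝ} (hρ : 0 < ρ) :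
    ‖gaussianDeriv n t‖ ≤ n.factorial * Real.exp (-t ^ 2 + 2 * ρ * |t| + ρ ^ 2) / ρ ^ n := by
  have hexp : Differentiable ℂ fun z : ℂ => Complex.exp (-z ^ 2) := by fun_prop
  refine Complex.norm_iteratedDeriv_le_of_forall_mem_sphere_norm_le n hρ
    hexp.diffContOnCl fun z hz => ?_
  have hre := re_neg_add_sq_le t (z - t)
  rw [add_sub_cancel, mem_sphere_iff_norm.1 hz] at hre
  rw [Complex.norm_exp]
  exact Real.exp_le_exp.2 hre

theorem ofReal_hermiteFun (n : ℕ) (t : ℝ) :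
    (hermiteFun n t : ℂ) = (Real.pi ^ (-(1 / 4) : ℝ) : ℝ) * (-√2 : ℂ)⁻¹ ^ n *
      (√(n.factorial : ℝ) : ℂ)⁻¹ * Complex.exp ((t : ℂ) ^ 2 / 2) * gaussianDeriv n t := by
  have hnorm : ((2 : ℝ) ^ n * n.factorial) ^ (-(1 / 2) : ℝ) =
      (√2)⁻¹ ^ n * (√(n.factorial : ℝ))⁻¹ := by
    have hpow : √((2 : ℝ) ^ n) = √2 ^ n := by
      rw [Real.sqrt_eq_iff_mul_self_eq (by positivity) (by positivity), ← mul_pow,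
        Real.mul_self_sqrt zero_le_two]
    rw [Real.rpow_neg (by positivity), ← Real.sqrt_eq_rpow, Real.sqrt_mul (by positivity), mul_inv,
      inv_pow, hpow]
  have hsign : (-1 : ℂ) ^ n * (√2 : ℂ)⁻¹ ^ n = (-√2 : ℂ)⁻¹ ^ n := by
    rw [← mul_pow, neg_one_mul, inv_neg]
  rw [hermiteFun, hnorm, ← hsign]
  push_cast [ofReal_iteratedDeriv_exp_neg_sq]
  ring

/-- A majorant of `R^n |h_n| / √n!`. -/
def hermiteMajorantOne (R t : ℝ) : ℝ :=
  Real.pi ^ (-(1 / 4) : ℝ) * Real.exp (-t ^ 2 / 2 + √2 * R * |t| + R ^ 2 / 2)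

theorem abs_hermiteFun_div_sqrt_le (n : ℕ) (t : ℝ) {R : ℝ} (hR : 0 < R) :
    |hermiteFun n t| / √(n.factorial : ℝ) ≤ R⁻¹ ^ n * hermiteMajorantOne R t := by
  have htwo : (0 : ℝ) < √2 := Real.sqrt_pos.2 two_pos
  have hfac : (0 : ℝ) < n.factorial := Nat.cast_pos.2 n.factorial_pos
  have hpi : (0 : ℝ) < Real.pi ^ (-(1 / 4) : ℝ) := Real.rpow_pos_of_pos Real.pi_pos _
  have habs : |hermiteFun n t| = Real.pi ^ (-(1 / 4) : ℝ) * (√2)⁻¹ ^ n *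
      (√(n.factorial : ℝ))⁻¹ * Real.exp (t ^ 2 / 2) * ‖gaussianDeriv n t‖ := by
    have hexp : ‖Complex.exp ((t : ℂ) ^ 2 / 2)‖ = Real.exp (t ^ 2 / 2) := by
      rw [Complex.norm_exp, ← Complex.ofReal_pow, ← Complex.ofReal_ofNat, ← Complex.ofReal_div,
        Complex.ofReal_re]
    rw [← Real.norm_eq_abs, ← Complex.norm_real, ofReal_hermiteFun]
    simp only [norm_mul, norm_inv, norm_pow, norm_neg, Complex.norm_real, Real.norm_eq_abs, hexp,
      abs_of_pos hpi, abs_of_pos htwo, abs_of_nonneg (Real.sqrt_nonneg _)]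
  have hexponent : t ^ 2 / 2 + (-t ^ 2 + 2 * (R / √2) * |t| + (R / √2) ^ 2) =
      -t ^ 2 / 2 + √2 * R * |t| + R ^ 2 / 2 := by
    rw [div_pow, Real.sq_sqrt zero_le_two, mul_div_left_comm, Real.div_sqrt]
    ring
  calc |hermiteFun n t| / √(n.factorial : ℝ)
      ≤ Real.pi ^ (-(1 / 4) : ℝ) * (√2)⁻¹ ^ n * (√(n.factorial : ℝ))⁻¹ * Real.exp (t ^ 2 / 2) *
          (n.factorial * Real.exp (-t ^ 2 + 2 * (R / √2) * |t| + (R / √2) ^ 2) / (R / √2) ^ n) /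
          √(n.factorial : ℝ) := by
        rw [habs]
        gcongr
        exact norm_gaussianDeriv_le n t (div_pos hR htwo)
    _ = R⁻¹ ^ n * hermiteMajorantOne R t := by
        rw [hermiteMajorantOne, ← hexponent, Real.exp_add (t ^ 2 / 2), inv_pow, inv_pow,
          (div_pow R (√2) n : (R / √2) ^ n = R ^ n / √2 ^ n)]
        field_simp
        rw [Real.sq_sqrt hfac.le]

theorem continuous_hermiteFun (n : ℕ) : Continuous (hermiteFun n) := by
  have hderiv := (differentiable_gaussianDeriv n).continuous
  refine Complex.isometry_ofReal.comp_continuous_iff.1 ?_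
  simp only [Function.comp_def, ofReal_hermiteFun]
  fun_prop

/-- The generating function `∑ h_n(t) w^n / √n!` of the Hermite functions in one variable. -/
def hermiteGenOne (w : ℂ) (t : ℝ) : ℂ :=
  (Real.pi ^ (-(1 / 4) : ℝ) : ℝ) * Complex.exp (-(t : ℂ) ^ 2 / 2 + √2 * t * w - w ^ 2 / 2)

theorem ofReal_sqrt_two_sq : (√2 : ℂ) ^ 2 = 2 := by
  exact_mod_cast congrArg Complex.ofReal (Real.sq_sqrt zero_le_two)

theorem ofReal_sqrt_two_ne_zero : (√2 : ℂ) ≠ 0 :=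
  Complex.ofReal_ne_zero.2 (Real.sqrt_pos.2 two_pos).ne'

/-- This is the Taylor expansion of `e^{-z²}` at `t`, evaluated at `t - w / √2`. -/
theorem hasSum_hermiteFun (w : ℂ) (t : ℝ) :
    HasSum (fun n => (hermiteFun n t : ℂ) * (w ^ n / √(n.factorial : ℝ))) (hermiteGenOne w t) := by
  have hexp : Differentiable ℂ fun z : ℂ => Complex.exp (-z ^ 2) := by fun_prop
  have htaylor := (Complex.hasSum_taylorSeries_of_entire hexp (t : ℂ)
    (t + w * (-√2 : ℂ)⁻¹)).mul_left ((Real.pi ^ (-(1 / 4) : ℝ) : ℝ) * Complex.exp (t ^ 2 / 2))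
  have hgen : (Real.pi ^ (-(1 / 4) : ℝ) : ℝ) * Complex.exp (t ^ 2 / 2) *
      Complex.exp (-(t + w * (-√2 : ℂ)⁻¹) ^ 2) = hermiteGenOne w t := by
    rw [hermiteGenOne, mul_assoc, ← Complex.exp_add]
    congr 2
    have := ofReal_sqrt_two_ne_zero
    field_simp
    linear_combination (w ^ 2 - (√2 : ℂ) * t * w * 2) * ofReal_sqrt_two_sq
  rw [hgen] at htaylor
  refine htaylor.congr_fun fun n => ?_
  have hsqrt : (√(n.factorial : ℝ) : ℂ)⁻¹ * (√(n.factorial : ℝ) : ℂ)⁻¹ = (n.factorial : ℂ)⁻¹ := by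
    rw [← mul_inv, ← Complex.ofReal_mul, Real.mul_self_sqrt (Nat.cast_nonneg _),
      Complex.ofReal_natCast]
  rw [ofReal_hermiteFun, add_sub_cancel_left, mul_pow, smul_eq_mul, smul_eq_mul, ← gaussianDeriv,
    ← hsqrt]
  ring

theorem integrable_exp_neg_sq_add_abs {b : ℝ} (hb : 0 < b) (c : ℝ) :
    Integrable fun t : ℝ => Real.exp (-b * t ^ 2 + c * |t|) := by
  refine ((integrable_exp_neg_mul_sq (half_pos hb)).mul_const (Real.exp (c ^ 2 / (2 * b)))).mono'
    (by fun_prop) (Filter.Eventually.of_forall fun t => ?_)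
  have hsq : 0 ≤ (b * |t| - c) ^ 2 / (2 * b) := by positivity
  have hexpand : (b * |t| - c) ^ 2 / (2 * b) = b / 2 * t ^ 2 - c * |t| + c ^ 2 / (2 * b) := by
    rw [← sq_abs t]
    field_simp
    ring
  rw [Real.norm_of_nonneg (Real.exp_pos _).le, ← Real.exp_add, Real.exp_le_exp]
  linarith

theorem norm_cexp_mul_ofReal_le (c : ℂ) (t : ℝ) :
    ‖Complex.exp (c * t)‖ ≤ Real.exp (‖c‖ * |t|) := by
  rw [Complex.norm_exp, Real.exp_le_exp]
  simpa only [norm_mul, Complex.norm_real, Real.norm_eq_abs] using Complex.re_le_norm (c * t)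

theorem integrable_cexp_mul_gaussianDeriv (c : ℂ) (n : ℕ) :
    Integrable fun t : ℝ => Complex.exp (c * t) * gaussianDeriv n t := by
  have hderiv := (differentiable_gaussianDeriv n).continuous
  refine ((integrable_exp_neg_sq_add_abs one_pos (2 + ‖c‖)).const_mul
    (n.factorial * Real.exp 1)).mono' (by fun_prop) (Filter.Eventually.of_forall fun t => ?_)
  have hgaussian := norm_gaussianDeriv_le n t one_pos
  simp only [one_pow, div_one, mul_one] at hgaussian
  calc ‖Complex.exp (c * t) * gaussianDeriv n t‖
      ≤ Real.exp (‖c‖ * |t|) * (n.factorial * Real.exp (-t ^ 2 + 2 * |t| + 1)) := by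
        rw [norm_mul]
        exact mul_le_mul (norm_cexp_mul_ofReal_le c t) hgaussian (norm_nonneg _) (Real.exp_pos _).le
    _ = n.factorial * Real.exp 1 * Real.exp (-1 * t ^ 2 + (2 + ‖c‖) * |t|) := by
        rw [mul_left_comm, mul_assoc, ← Real.exp_add, ← Real.exp_add]
        ring_nf

theorem integral_cexp_mul_gaussianDeriv (c : ℂ) (n : ℕ) :
    ∫ t : ℝ, Complex.exp (c * t) * gaussianDeriv n t =
      (-c) ^ n * (√Real.pi * Complex.exp (c ^ 2 / 4)) := by
  induction n with
  | zero =>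
    have hsqrt : (√Real.pi : ℂ) = (Real.pi / - -1 : ℂ) ^ (1 / 2 : ℂ) := by
      rw [Real.sqrt_eq_rpow, Complex.ofReal_cpow Real.pi_pos.le]
      norm_num
    have hexp : c ^ 2 / 4 = 0 - c ^ 2 / (4 * -1) := by ring
    rw [hsqrt, hexp, pow_zero, one_mul, ← integral_cexp_quadratic (b := -1) (by simp) c 0]
    simp only [gaussianDeriv, iteratedDeriv_zero, ← Complex.exp_add]
    ring_nf
  | succ n ih =>
    have hexp : ∀ t : ℝ,
        HasDerivAt (fun t : ℝ => Complex.exp (c * t)) (c * Complex.exp (c * t)) t := fun t => by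
      simpa [mul_comm] using ((hasDerivAt_id (t : ℂ)).const_mul c).cexp.comp_ofReal
    rw [integral_mul_deriv_eq_deriv_mul_of_integrable (fun t _ => hexp t)
      (fun t _ => hasDerivAt_gaussianDeriv n t) (integrable_cexp_mul_gaussianDeriv c (n + 1))
      (by simpa only [Pi.mul_def, mul_assoc] using
        (integrable_cexp_mul_gaussianDeriv c n).const_mul c)
      (integrable_cexp_mul_gaussianDeriv c n)]
    simp only [mul_assoc, integral_const_mul, ih]
    ring

theorem ofReal_pi_rpow_mul_self_mul_sqrt :
    ((Real.pi ^ (-(1 / 4) : ℝ) : ℝ) : ℂ) * (Real.pi ^ (-(1 / 4) : ℝ) : ℝ) * √Real.pi = 1 := by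
  rw [← Complex.ofReal_mul, ← Complex.ofReal_mul, Real.sqrt_eq_rpow,
    ← Real.rpow_add Real.pi_pos, ← Real.rpow_add Real.pi_pos]
  norm_num

theorem integral_hermiteFun_mul_hermiteGenOne (n : ℕ) (w : ℂ) :
    ∫ t, (hermiteFun n t : ℂ) * hermiteGenOne w t = w ^ n / √(n.factorial : ℝ) := by
  set κ : ℂ := ((Real.pi ^ (-(1 / 4) : ℝ) : ℝ) : ℂ)
  have hproduct : ∀ t : ℝ, (hermiteFun n t : ℂ) * hermiteGenOne w t =
      κ * κ * (-√2 : ℂ)⁻¹ ^ n * (√(n.factorial : ℝ) : ℂ)⁻¹ * Complex.exp (-w ^ 2 / 2) *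
        (Complex.exp (√2 * w * t) * gaussianDeriv n t) := fun t => by
    have hexp : Complex.exp ((t : ℂ) ^ 2 / 2) *
        Complex.exp (-(t : ℂ) ^ 2 / 2 + √2 * t * w - w ^ 2 / 2) =
        Complex.exp (-w ^ 2 / 2) * Complex.exp (√2 * w * t) := by
      rw [← Complex.exp_add, ← Complex.exp_add]
      ring_nf
    rw [ofReal_hermiteFun, hermiteGenOne]
    linear_combination κ * κ * (-√2 : ℂ)⁻¹ ^ n * (√(n.factorial : ℝ) : ℂ)⁻¹ *
      gaussianDeriv n t * hexp
  have hexp : Complex.exp (-w ^ 2 / 2) * Complex.exp ((√2 * w) ^ 2 / 4) = 1 := by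
    rw [← Complex.exp_add, mul_pow, ofReal_sqrt_two_sq, ← Complex.exp_zero]
    ring_nf
  have hpow : (-√2 : ℂ)⁻¹ ^ n * (-(√2 * w)) ^ n = w ^ n := by
    rw [← mul_pow, ← neg_mul, inv_mul_cancel_left₀ (neg_ne_zero.2 ofReal_sqrt_two_ne_zero)]
  simp only [hproduct, integral_const_mul, integral_cexp_mul_gaussianDeriv]
  calc κ * κ * (-√2 : ℂ)⁻¹ ^ n * (√(n.factorial : ℝ) : ℂ)⁻¹ * Complex.exp (-w ^ 2 / 2) *
        ((-(√2 * w)) ^ n * (√Real.pi * Complex.exp ((√2 * w) ^ 2 / 4)))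
      = κ * κ * √Real.pi * (Complex.exp (-w ^ 2 / 2) * Complex.exp ((√2 * w) ^ 2 / 4)) *
          ((-√2 : ℂ)⁻¹ ^ n * (-(√2 * w)) ^ n) * (√(n.factorial : ℝ) : ℂ)⁻¹ := by ring
    _ = w ^ n / √(n.factorial : ℝ) := by
        rw [hexp, hpow, ofReal_pi_rpow_mul_self_mul_sqrt, one_mul, one_mul, div_eq_mul_inv]

theorem integrable_hermiteMajorantOne_pow (R : ℝ) {k : ℕ} (hk : k ≠ 0) :
    Integrable fun t => hermiteMajorantOne R t ^ k := by
  have hk : (0 : ℝ) < k := Nat.cast_pos.2 (Nat.pos_of_ne_zero hk)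
  refine ((integrable_exp_neg_sq_add_abs (half_pos hk) (k * (√2 * R))).const_mul
    ((Real.pi ^ (-(1 / 4) : ℝ)) ^ k * Real.exp (k * (R ^ 2 / 2)))).congr
      (Filter.Eventually.of_forall fun t => ?_)
  simp only [hermiteMajorantOne]
  rw [mul_pow, mul_assoc, ← Real.exp_add, ← Real.exp_nat_mul]
  ring_nf

end HermiteOne

section HermiteSeveral

/-- A majorant of `R^α |h_α| / √α!`. -/
def hermiteMajorant (R x : Fin d → ℝ) : ℝ := ∏ j, hermiteMajorantOne (R j) (x j)

theorem hermiteMajorant_nonneg (R x : Fin d → ℝ) : 0 ≤ hermiteMajorant R x :=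
  Finset.prod_nonneg fun _ _ => mul_nonneg (Real.rpow_nonneg Real.pi_pos.le _) (Real.exp_pos _).le

theorem continuous_hermiteMajorant (R : Fin d → ℝ) : Continuous (hermiteMajorant R) := by
  unfold hermiteMajorant hermiteMajorantOne
  fun_prop

theorem integrable_hermiteMajorant_pow (R : Fin d → ℝ) {k : ℕ} (hk : k ≠ 0) :
    Integrable fun x => hermiteMajorant R x ^ k := by
  simp only [hermiteMajorant, ← Finset.prod_pow]
  exact Integrable.fintype_prod (f := fun j t => hermiteMajorantOne (R j) t ^ k)
    fun j => integrable_hermiteMajorantOne_pow (R j) hk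

theorem memLp_hermiteMajorant (R : Fin d → ℝ) : MemLp (hermiteMajorant R) 2 :=
  (memLp_two_iff_integrable_sq (continuous_hermiteMajorant R).aestronglyMeasurable).2
    (integrable_hermiteMajorant_pow R two_ne_zero)

theorem continuous_hermite (α : Fin d → ℕ) : Continuous (hermite α) :=
  continuous_finsetProd _ fun j _ => (continuous_hermiteFun (α j)).comp (continuous_apply j)

theorem abs_hermite_div_sqrt_le (α : Fin d → ℕ) (x : Fin d → ℝ) {R : Fin d → ℝ} (hR : Pos R) :
    |hermite α x| / √(multiFactorial α : ℝ) ≤ mpow R⁻¹ α * hermiteMajorant R x := by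
  rw [hermite, Finset.abs_prod, sqrt_multiFactorial, ← Finset.prod_div_distrib, mpow,
    hermiteMajorant, ← Finset.prod_mul_distrib]
  exact Finset.prod_le_prod (fun _ _ => by positivity)
    fun j _ => abs_hermiteFun_div_sqrt_le (α j) (x j) (hR j)

theorem norm_hermite_le (α : Fin d → ℕ) (x : Fin d → ℝ) :
    ‖hermite α x‖ ≤ √(multiFactorial α : ℝ) * hermiteMajorant 1 x := by
  have h := abs_hermite_div_sqrt_le α x Pos.one
  rwa [inv_one, one_mpow, one_mul, div_le_iff₀' (sqrt_multiFactorial_pos α)] at h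

theorem integrable_hermite (α : Fin d → ℕ) : Integrable (hermite α) := by
  refine Integrable.mono' ?_ (continuous_hermite α).aestronglyMeasurable
    (Filter.Eventually.of_forall (norm_hermite_le α))
  simpa only [pow_one] using (integrable_hermiteMajorant_pow 1 one_ne_zero).const_mul _

theorem memLp_hermite (α : Fin d → ℕ) : MemLp (hermite α) 2 :=
  ((memLp_hermiteMajorant 1).const_mul _).mono' (continuous_hermite α).aestronglyMeasurable
    (Filter.Eventually.of_forall (norm_hermite_le α))

theorem hermiteCoeff_sub {f g : (Fin d → ℝ) → ℂ} (hf : MemLp f 2) (hg : MemLp g 2) :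
    hermiteCoeff (f - g) = hermiteCoeff f - hermiteCoeff g := by
  ext α
  simp only [hermiteCoeff, Pi.sub_apply, sub_mul]
  exact integral_sub (hf.integrable_mul (memLp_hermite α).ofReal)
    (hg.integrable_mul (memLp_hermite α).ofReal)

theorem hermiteCoeff_congr {f g : (Fin d → ℝ) → ℂ} (h : f =ᵐ[volume] g) :
    hermiteCoeff f = hermiteCoeff g :=
  funext fun _ => integral_congr_ae (h.mono fun x hx => by simp only [hx])

/-- The generating function `∑ h_α(x) w^α / √α!` of the Hermite functions. -/
def hermiteGen (w : Fin d → ℂ) (x : Fin d → ℝ) : ℂ := ∏ j, hermiteGenOne (w j) (x j)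

theorem hasSum_hermite (w : Fin d → ℂ) (x : Fin d → ℝ) :
    HasSum (fun α => (hermite α x : ℂ) * (mpow w α / √(multiFactorial α : ℝ)))
      (hermiteGen w x) := by
  have h := hasSum_pi_prod fun j => hasSum_hermiteFun (w j) (x j)
  simpa only [Finset.prod_mul_distrib, Finset.prod_div_distrib, sqrt_multiFactorial, hermite, mpow,
    hermiteGen, Complex.ofReal_prod] using h

theorem integral_hermite_mul_hermiteGen (α : Fin d → ℕ) (w : Fin d → ℂ) :
    ∫ x, (hermite α x : ℂ) * hermiteGen w x = mpow w α / √(multiFactorial α : ℝ) := by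
  simp only [hermite, hermiteGen, Complex.ofReal_prod, ← Finset.prod_mul_distrib]
  rw [integral_fintype_prod_volume_eq_prod
    fun j (t : ℝ) => (hermiteFun (α j) t : ℂ) * hermiteGenOne (w j) t]
  simp only [integral_hermiteFun_mul_hermiteGenOne, Finset.prod_div_distrib, sqrt_multiFactorial,
    mpow, Complex.ofReal_prod]

theorem norm_hermite_mul_mpow_div_le (α : Fin d → ℕ) (x : Fin d → ℝ) {w : Fin d → ℂ}
    {R : Fin d → ℝ} (hR : Pos R) (hw : ∀ j, ‖w j‖ ≤ R j) :
    ‖(hermite α x : ℂ) * (mpow w α / √(multiFactorial α : ℝ))‖ ≤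
      mpow 2⁻¹ α * hermiteMajorant (2 * R) x := by
  have htwoR : mpow (2 * R)⁻¹ α * mpow R α = mpow 2⁻¹ α := by
    rw [mul_inv, mul_mpow, mul_assoc, mpow_inv_mul_mpow hR, mul_one]
  calc ‖(hermite α x : ℂ) * (mpow w α / √(multiFactorial α : ℝ))‖
      = |hermite α x| / √(multiFactorial α : ℝ) * ‖mpow w α‖ := by
        rw [norm_mul, norm_div, Complex.norm_real, Complex.norm_real, Real.norm_eq_abs,
          Real.norm_of_nonneg (Real.sqrt_nonneg _)]
        ring
    _ ≤ mpow (2 * R)⁻¹ α * hermiteMajorant (2 * R) x * mpow R α :=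
        mul_le_mul (abs_hermite_div_sqrt_le α x (Pos.two.mul hR)) (norm_mpow_le hw α)
          (norm_nonneg _) (mul_nonneg ((Pos.two.mul hR).inv.mpow α).le (hermiteMajorant_nonneg _ _))
    _ = mpow 2⁻¹ α * hermiteMajorant (2 * R) x := by rw [mul_right_comm, htwoR]

theorem hasSum_hermiteCoeff {f : (Fin d → ℝ) → ℂ} (hf : MemLp f 2) (w : Fin d → ℂ) :
    HasSum (fun α => hermiteCoeff f α * (mpow w α / √(multiFactorial α : ℝ)))
      (∫ x, f x * hermiteGen w x) := by
  set R : Fin d → ℝ := fun j => ‖w j‖ + 1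
  have hR : Pos R := fun j => by positivity
  have hbound : ∀ α x, ‖f x * ((hermite α x : ℂ) * (mpow w α / √(multiFactorial α : ℝ)))‖ ≤
      mpow 2⁻¹ α * (‖f x‖ * hermiteMajorant (2 * R) x) := fun α x => by
    rw [norm_mul, mul_left_comm]
    exact mul_le_mul_of_nonneg_left
      (norm_hermite_mul_mpow_div_le α x hR fun j => (lt_add_one _).le) (norm_nonneg _)
  have hmeas : ∀ α, AEStronglyMeasurable (fun x =>
      f x * ((hermite α x : ℂ) * (mpow w α / √(multiFactorial α : ℝ)))) := fun α =>
    hf.aestronglyMeasurable.mul ((Complex.continuous_ofReal.comp (continuous_hermite α)).mul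
      continuous_const).aestronglyMeasurable
  have h := hasSum_integral_of_dominated_convergence _ hmeas
    (fun α => Filter.Eventually.of_forall (hbound α))
    (Filter.Eventually.of_forall fun x => summable_mpow_half.mul_right _)
    (by
      simp_rw [tsum_mul_right]
      exact (hf.norm.integrable_mul (memLp_hermiteMajorant _)).const_mul _)
    (Filter.Eventually.of_forall fun x => (hasSum_hermite w x).mul_left (f x))
  refine h.congr_fun fun α => ?_
  simp only [hermiteCoeff, ← integral_mul_const, mul_assoc]

end HermiteSeveral

section FourierUniqueness

open scoped FourierTransform

theorem ae_eq_zero_of_fourier_eq_zero {E : Type*} [NormedAddCommGroup E] [InnerProductSpace ℝ E]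
    [FiniteDimensional ℝ E] [MeasurableSpace E] [BorelSpace E] {f : E → ℂ} (hf : Integrable f)
    (h : 𝓕 f = 0) : f =ᵐ[volume] 0 := by
  refine ae_eq_zero_of_integral_contDiff_smul_eq_zero hf.locallyIntegrable
    fun g hg hgsupp => ?_
  have hgC : HasCompactSupport fun x => (g x : ℂ) :=
    hgsupp.comp_left (g := Complex.ofReal) Complex.ofReal_zero
  set φ : SchwartzMap E ℂ := hgC.toSchwartzMap (Complex.ofRealCLM.contDiff.comp hg)
  set ψ : SchwartzMap E ℂ := 𝓕⁻ φ
  have hψ : 𝓕 (ψ : E → ℂ) = φ := by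
    rw [← SchwartzMap.fourier_coe, FourierTransform.fourier_fourierInv_eq]
  have hflip : ∫ ξ, 𝓕 f ξ • ψ ξ = ∫ x, f x • 𝓕 (ψ : E → ℂ) x := by
    simpa using! VectorFourier.integral_fourierIntegral_smul_eq_flip (L := innerₗ E)
      Real.continuous_fourierChar continuous_inner hf ψ.integrable
  simp only [h, hψ, Pi.zero_apply, zero_smul, integral_zero] at hflip
  rw [hflip]
  exact integral_congr_ae (Filter.Eventually.of_forall fun x => mul_comm _ _)

theorem ae_eq_zero_of_integral_mul_character_eq_zero {f : (Fin d → ℝ) → ℂ} (hf : Integrable f)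
    (h : ∀ ξ : Fin d → ℝ, ∫ x, f x * Complex.exp (Complex.I * (dot x ξ : ℂ)) = 0) :
    f =ᵐ[volume] 0 := by
  have hofLp := PiLp.volume_preserving_ofLp (Fin d)
  have hfE : Integrable fun x : EuclideanSpace ℝ (Fin d) => f x.ofLp :=
    (hofLp.integrable_comp_emb (MeasurableEquiv.toLp 2 _).symm.measurableEmbedding).2 hf
  have hfourier : 𝓕 (fun x : EuclideanSpace ℝ (Fin d) => f x.ofLp) = 0 := by
    ext ξ
    rw [Real.fourier_eq', Pi.zero_apply, ← h fun j => -2 * Real.pi * ξ j,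
      ← hofLp.integral_comp (MeasurableEquiv.toLp 2 _).symm.measurableEmbedding]
    refine integral_congr_ae (Filter.Eventually.of_forall fun x => ?_)
    have hdot : dot x.ofLp (fun j => -2 * Real.pi * ξ j) = -2 * Real.pi * inner ℝ x ξ := by
      simp only [dot, PiLp.inner_apply, Finset.mul_sum, RCLike.inner_apply, conj_trivial]
      exact Finset.sum_congr rfl fun j _ => by ring
    beta_reduce
    rw [hdot, smul_eq_mul, mul_comm (f _), mul_comm Complex.I]
  exact ((PiLp.volume_preserving_toLp (Fin d)).quasiMeasurePreserving.ae
    (ae_eq_zero_of_fourier_eq_zero hfE hfourier))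

end FourierUniqueness

section Completeness

theorem continuous_gaussian : Continuous (gaussian (d := d)) := by
  unfold gaussian dot
  fun_prop

theorem gaussian_eq_prod (x : Fin d → ℝ) :
    gaussian x = ∏ j, (Real.pi ^ (-(1 / 4) : ℝ) * Real.exp (-x j ^ 2 / 2)) := by
  rw [Finset.prod_mul_distrib, ← Real.exp_sum, Finset.prod_const, Finset.card_univ,
    Fintype.card_fin, ← Real.rpow_natCast, ← Real.rpow_mul Real.pi_pos.le, gaussian, dot,
    ← Finset.sum_neg_distrib, Finset.sum_div]
  congr 2
  · ring
  · exact Finset.sum_congr rfl fun j _ => by ring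

theorem gaussian_eq_hermiteMajorant : gaussian = hermiteMajorant (0 : Fin d → ℝ) := by
  ext x
  simp [gaussian_eq_prod, hermiteMajorant, hermiteMajorantOne]

theorem gaussian_pos (x : Fin d → ℝ) : 0 < gaussian x :=
  mul_pos (Real.rpow_pos_of_pos Real.pi_pos _) (Real.exp_pos _)

theorem gaussian_mul_character (x y η : Fin d → ℝ) :
    (gaussian (x - y) : ℂ) * Complex.exp (Complex.I * (dot x η : ℂ)) =
      hermiteGen (fun j => ((y j : ℂ) + Complex.I * η j) / √2) x *
        Complex.exp (Complex.I * (dot y η : ℂ) / 2 - ∑ j, ((y j : ℂ) ^ 2 + (η j : ℂ) ^ 2) / 4) := by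
  rw [gaussian_eq_prod, dot, dot, hermiteGen]
  push_cast
  rw [Finset.mul_sum, Finset.mul_sum, Finset.sum_div, ← Finset.sum_sub_distrib, Complex.exp_sum,
    Complex.exp_sum, ← Finset.prod_mul_distrib, ← Finset.prod_mul_distrib]
  refine Finset.prod_congr rfl fun j _ => ?_
  rw [hermiteGenOne, mul_assoc, mul_assoc, ← Complex.exp_add, ← Complex.exp_add]
  push_cast [Pi.sub_apply]
  congr 2
  rw [div_pow, ofReal_sqrt_two_sq, mul_assoc, mul_left_comm (√2 : ℂ),
    mul_div_cancel₀ _ ofReal_sqrt_two_ne_zero]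
  linear_combination ((η j : ℂ) ^ 2 / 4) * Complex.I_sq

theorem ae_eq_zero_of_hermiteCoeff_eq_zero {f : (Fin d → ℝ) → ℂ} (hf : MemLp f 2)
    (h : hermiteCoeff f = 0) : f =ᵐ[volume] 0 := by
  have hgen (w : Fin d → ℂ) : ∫ x, f x * hermiteGen w x = 0 := by
    have hsum := hasSum_hermiteCoeff hf w
    simp only [h, Pi.zero_apply, zero_mul] at hsum
    exact hsum.unique hasSum_zero
  have hgaussian : MemLp (fun x : Fin d → ℝ => (gaussian x : ℂ)) 2 := by
    rw [gaussian_eq_hermiteMajorant]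
    exact (memLp_hermiteMajorant 0).ofReal
  have hprod : (fun x => f x * (gaussian x : ℂ)) =ᵐ[volume] 0 := by
    refine ae_eq_zero_of_integral_mul_character_eq_zero (hf.integrable_mul hgaussian) fun ξ => ?_
    have hkernel (x : Fin d → ℝ) := gaussian_mul_character x 0 ξ
    simp only [sub_zero] at hkernel
    simp only [mul_assoc, hkernel]
    simp only [← mul_assoc, integral_mul_const, hgen, zero_mul]
  filter_upwards [hprod] with x hx
  exact (mul_eq_zero.1 hx).resolve_right (Complex.ofReal_ne_zero.2 (gaussian_pos x).ne')

end Completeness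

section Adjoint

theorem gaussian_le (x : Fin d → ℝ) : gaussian x ≤ Real.pi ^ (-(d : ℝ) / 4) := by
  have hdot : 0 ≤ dot x x := Finset.sum_nonneg fun j _ => mul_self_nonneg (x j)
  exact mul_le_of_le_one_right (Real.rpow_nonneg Real.pi_pos.le _)
    (Real.exp_le_one_iff.2 (by linarith))

theorem integrable_gaussian : Integrable (gaussian (d := d)) := by
  rw [gaussian_eq_hermiteMajorant]
  simpa using integrable_hermiteMajorant_pow (0 : Fin d → ℝ) one_ne_zero

/-- The time-frequency shifts `x ↦ φ(x - y) e^{i⟨x, η⟩}`, `p = (y, η)`, of the Gaussian window: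
`V_φ^*` is the integral operator with this kernel. -/
def stftKernel (p : (Fin d → ℝ) × (Fin d → ℝ)) (x : Fin d → ℝ) : ℂ :=
  gaussian (x - p.1) * Complex.exp (Complex.I * dot x p.2)

theorem continuous_stftKernel :
    Continuous fun q : ((Fin d → ℝ) × (Fin d → ℝ)) × (Fin d → ℝ) => stftKernel q.1 q.2 := by
  have := continuous_gaussian (d := d)
  unfold stftKernel dot
  fun_prop

theorem norm_stftKernel (p : (Fin d → ℝ) × (Fin d → ℝ)) (x : Fin d → ℝ) :
    ‖stftKernel p x‖ = gaussian (x - p.1) := by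
  rw [stftKernel, norm_mul, mul_comm Complex.I, Complex.norm_exp_ofReal_mul_I, mul_one,
    Complex.norm_of_nonneg (gaussian_pos _).le]

theorem stftAdjoint_eq_integral_stftKernel (F : (Fin d → ℝ) × (Fin d → ℝ) → ℂ) (x : Fin d → ℝ) :
    stftAdjoint F x = ∫ p, F p * stftKernel p x := by
  simp only [stftAdjoint, stftKernel, mul_assoc]

variable {F : (Fin d → ℝ) × (Fin d → ℝ) → ℂ}

theorem integrable_mul_stftKernel (hF : Integrable F) :
    Integrable (fun q : ((Fin d → ℝ) × (Fin d → ℝ)) × (Fin d → ℝ) => F q.1 * stftKernel q.1 q.2)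
      (volume.prod volume) := by
  have hmeas : AEStronglyMeasurable (fun q : ((Fin d → ℝ) × (Fin d → ℝ)) × (Fin d → ℝ) =>
      F q.1 * stftKernel q.1 q.2) (volume.prod volume) :=
    hF.1.comp_fst.mul continuous_stftKernel.aestronglyMeasurable
  refine (integrable_prod_iff hmeas).2 ⟨?_, ?_⟩
  · refine Filter.Eventually.of_forall fun p => ?_
    have hkernel : AEStronglyMeasurable (stftKernel p) :=
      (continuous_stftKernel.comp (Continuous.prodMk_right p)).aestronglyMeasurable
    refine ((integrable_norm_iff hkernel).1 ?_).const_mul (F p)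
    simp only [norm_stftKernel]
    exact integrable_gaussian.comp_sub_right p.1
  · simp only [norm_mul, norm_stftKernel, integral_const_mul,
      integral_sub_right_eq_self (gaussian (d := d))]
    exact hF.norm.mul_const _

theorem norm_stftAdjoint_le (hF : Integrable F) (x : Fin d → ℝ) :
    ‖stftAdjoint F x‖ ≤ (∫ p, ‖F p‖) * Real.pi ^ (-(d : ℝ) / 4) := by
  rw [stftAdjoint_eq_integral_stftKernel, ← integral_mul_const]
  refine norm_integral_le_of_norm_le (hF.norm.mul_const _) (Filter.Eventually.of_forall fun p => ?_)
  rw [norm_mul, norm_stftKernel]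
  exact mul_le_mul_of_nonneg_left (gaussian_le _) (norm_nonneg _)

theorem memLp_stftAdjoint (hF : Integrable F) : MemLp (stftAdjoint F) 2 := by
  have hint : Integrable (stftAdjoint F) :=
    (integrable_mul_stftKernel hF).integral_prod_right.congr
      (Filter.Eventually.of_forall fun x => (stftAdjoint_eq_integral_stftKernel F x).symm)
  rw [memLp_two_iff_integrable_sq_norm hint.1]
  refine (hint.norm.const_mul ((∫ p, ‖F p‖) * Real.pi ^ (-(d : ℝ) / 4))).mono' (hint.1.norm.pow 2)
    (Filter.Eventually.of_forall fun x => ?_)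
  rw [norm_pow, norm_norm, sq]
  exact mul_le_mul_of_nonneg_right (norm_stftAdjoint_le hF x) (norm_nonneg _)

/-- The factor `√(2^{|α|} α!)` by which the Hermite coefficients of `V_φ^* F` differ from moments
of `F`. -/
def hermiteScale (d : ℕ) (α : Fin d → ℕ) : ℝ := mpow (fun _ => √2) α * √(multiFactorial α : ℝ)

theorem integral_hermite_mul_stftKernel (α : Fin d → ℕ) (p : (Fin d → ℝ) × (Fin d → ℝ)) :
    hermiteScale d α * ∫ x, (hermite α x : ℂ) * stftKernel p x =
      Complex.exp (Complex.I * (dot p.1 p.2 : ℂ) / 2 -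
        ∑ j, ((p.1 j : ℂ) ^ 2 + (p.2 j : ℂ) ^ 2) / 4) *
        mpow (fun j => (p.1 j : ℂ) + Complex.I * p.2 j) α := by
  have hscale : mpow (fun j => (p.1 j : ℂ) + Complex.I * p.2 j) α = mpow (fun _ => (√2 : ℂ)) α *
      mpow (fun j => ((p.1 j : ℂ) + Complex.I * p.2 j) / √2) α := by
    rw [← mul_mpow]
    exact congrArg (mpow · α) (funext fun j => (mul_div_cancel₀ _ ofReal_sqrt_two_ne_zero).symm)
  have hfactorial : (√(multiFactorial α : ℝ) : ℂ) ≠ 0 :=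
    Complex.ofReal_ne_zero.2 (sqrt_multiFactorial_pos α).ne'
  simp only [stftKernel, gaussian_mul_character, ← mul_assoc]
  rw [integral_mul_const, integral_hermite_mul_hermiteGen, hscale, hermiteScale]
  simp only [mpow, Complex.ofReal_mul, Complex.ofReal_prod, Complex.ofReal_pow]
  field_simp

theorem hermiteCoeff_stftAdjoint (hF : Integrable F) (α : Fin d → ℕ) :
    hermiteScale d α * hermiteCoeff (stftAdjoint F) α =
      ∫ p, F p * (Complex.exp (Complex.I * (dot p.1 p.2 : ℂ) / 2 -
        ∑ j, ((p.1 j : ℂ) ^ 2 + (p.2 j : ℂ) ^ 2) / 4) *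
        mpow (fun j => (p.1 j : ℂ) + Complex.I * p.2 j) α) := by
  have hint : Integrable (fun q : ((Fin d → ℝ) × (Fin d → ℝ)) × (Fin d → ℝ) =>
      (F q.1 * (hermite α q.2 : ℂ)) * stftKernel q.1 q.2) (volume.prod volume) :=
    (hF.mul_prod (integrable_hermite α).ofReal).mul_bdd
      continuous_stftKernel.aestronglyMeasurable
      (Filter.Eventually.of_forall fun q => (norm_stftKernel q.1 q.2).trans_le (gaussian_le _))
  have hfubini : hermiteCoeff (stftAdjoint F) α =
      ∫ p, ∫ x, (F p * (hermite α x : ℂ)) * stftKernel p x := by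
    rw [integral_integral_swap hint, hermiteCoeff]
    refine integral_congr_ae (Filter.Eventually.of_forall fun x => ?_)
    simp only [stftAdjoint_eq_integral_stftKernel, ← integral_mul_const, mul_right_comm]
  rw [hfubini, ← integral_const_mul]
  refine integral_congr_ae (Filter.Eventually.of_forall fun p => ?_)
  simp only [mul_assoc, integral_const_mul]
  rw [mul_left_comm, integral_hermite_mul_stftKernel]

end Adjoint

section ComplexCoordinates

theorem integrable_of_memLp_top {X E : Type*} [MeasurableSpace X] [NormedAddCommGroup E]
    {μ : Measure X} {f : X → E} (hf : MemLp f ∞ μ) {s : Set X}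
    (hμ : μ s ≠ ∞) (h0 : ∀ᵐ x ∂μ, x ∉ s → f x = 0) : Integrable f μ := by
  have : IsFiniteMeasure (μ.restrict s) := ⟨by simpa using hμ.lt_top⟩
  have hs : IntegrableOn f s μ :=
    memLp_one_iff_integrable.1 ((hf.mono_measure Measure.restrict_le_self).mono_exponent le_top)
  exact hs.integrable_of_ae_notMem_eq_zero h0

theorem IsBoundedCompact.integrable {F : (Fin d → ℝ) × (Fin d → ℝ) → ℂ}
    (hF : IsBoundedCompact F) : Integrable F := by
  obtain ⟨hbounded, K, hK, hsupport⟩ := hF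
  exact integrable_of_memLp_top hbounded hK.measure_lt_top.ne hsupport

/-- The identification `(x, ξ) ↦ x + iξ` of `ℝᵈ × ℝᵈ` with `ℂᵈ`. -/
def complexEquiv (d : ℕ) : (Fin d → ℝ) × (Fin d → ℝ) ≃ᵐ (Fin d → ℂ) :=
  (MeasurableEquiv.arrowProdEquivProdArrow ℝ ℝ (Fin d)).symm.trans
    (MeasurableEquiv.piCongrRight fun _ => Complex.measurableEquivRealProd.symm)

theorem complexEquiv_apply (p : (Fin d → ℝ) × (Fin d → ℝ)) (j : Fin d) :
    complexEquiv d p j = (p.1 j : ℂ) + Complex.I * p.2 j := by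
  have h : complexEquiv d p j = ⟨p.1 j, p.2 j⟩ := rfl
  rw [h]
  refine Complex.ext ?_ ?_ <;> simp

theorem measurePreserving_complexEquiv : MeasurePreserving (complexEquiv d) :=
  (volume_preserving_pi fun _ => Complex.volume_preserving_equiv_real_prod.symm).comp
    (volume_measurePreserving_arrowProdEquivProdArrow ℝ ℝ (Fin d)).symm

end ComplexCoordinates

section Moments

theorem mpow_mulSingle {R : Type*} [CommMonoid R] (j : Fin d) (w : R) (α : Fin d → ℕ) :
    mpow (Pi.mulSingle j w) α = w ^ α j := by
  rw [mpow, Finset.prod_eq_single_of_mem j (Finset.mem_univ j), Pi.mulSingle_eq_same]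
  intro i _ hi
  rw [Pi.mulSingle_eq_of_ne hi, one_pow]

theorem mpow_star (z : Fin d → ℂ) (α : Fin d → ℕ) : mpow (star z) α = star (mpow z α) := by
  simp only [mpow, Pi.star_apply, star_prod, star_pow]

theorem measurePreserving_mul_circle (u : Fin d → Circle) :
    MeasurePreserving fun (z : Fin d → ℂ) j => (u j : ℂ) * z j :=
  volume_preserving_pi fun j => (rotation (u j)).measurePreserving

theorem integral_comp_mul_circle (u : Fin d → Circle) (k : (Fin d → ℂ) → ℂ) :
    ∫ z : Fin d → ℂ, k (fun j => (u j : ℂ) * z j) = ∫ z, k z :=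
  (measurePreserving_mul_circle u).integral_comp
    (MeasurableEquiv.piCongrRight fun j =>
      (rotation (u j)).toHomeomorph.toMeasurableEquiv).measurableEmbedding k

theorem exists_circle_star_pow_mul_pow {m n : ℕ} (h : m ≠ n) :
    ∃ w : Circle, star (w : ℂ) ^ m * (w : ℂ) ^ n = -1 := by
  have hne : (n : ℂ) - m ≠ 0 := sub_ne_zero.2 (Nat.cast_injective.ne h.symm)
  refine ⟨Circle.exp (Real.pi / (n - m)), ?_⟩
  rw [Circle.coe_exp, Complex.star_def, ← Complex.exp_conj, ← Complex.exp_nat_mul,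
    ← Complex.exp_nat_mul, ← Complex.exp_add, ← Complex.exp_pi_mul_I]
  congr 1
  simp only [map_mul, Complex.conj_I, Complex.conj_ofReal]
  push_cast
  field_simp
  ring

/-- The function `ω` is integrable, depends on the moduli `|z₁|, …, |z_d|` only and vanishes
outside the closed polydisc with radii `t`. As for `RClassWith`, these are conditions almost
everywhere. -/
structure IsPolyradial (ω : (Fin d → ℂ) → ℝ) (t : Fin d → ℝ) : Prop where
  radii_nonneg : 0 ≤ t
  integrable : Integrable ω
  support : ∀ᵐ z : Fin d → ℂ, ¬ (∀ j, ‖z j‖ ≤ t j) → ω z = 0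
  radial : ∃ ω₀ : (Fin d → ℝ) → ℝ, ∀ᵐ z, ω z = ω₀ fun j => ‖z j‖

/-- The moment `∫ ω(z) |z^α|² dz`. -/
def radialMoment (ω : (Fin d → ℂ) → ℝ) (α : Fin d → ℕ) : ℝ := ∫ z, ω z * ‖mpow z α‖ ^ 2

theorem integral_star_mpow_mul_mpow_self (ω : (Fin d → ℂ) → ℝ) (α : Fin d → ℕ) :
    ∫ z, (ω z : ℂ) * (star (mpow z α) * mpow z α) = radialMoment ω α := by
  rw [radialMoment, ← integral_complex_ofReal]
  simp only [Complex.star_def, Complex.conj_mul', Complex.ofReal_mul, Complex.ofReal_pow]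

namespace IsPolyradial

variable {ω : (Fin d → ℂ) → ℝ} {t : Fin d → ℝ}

theorem ae_comp_mul_circle (hω : IsPolyradial ω t) (u : Fin d → Circle) :
    ∀ᵐ z : Fin d → ℂ, ω (fun j => (u j : ℂ) * z j) = ω z := by
  obtain ⟨ω₀, hω₀⟩ := hω.radial
  filter_upwards [hω₀, (measurePreserving_mul_circle u).quasiMeasurePreserving.ae hω₀]
    with z hz huz
  simp only [hz, huz, norm_mul, Circle.norm_coe, one_mul]

/-- A rotation of one variable by a suitable angle multiplies the integrand by `-1`. -/
theorem integral_star_mpow_mul_mpow_of_ne (hω : IsPolyradial ω t) {α β : Fin d → ℕ} (h : α ≠ β) :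
    ∫ z, (ω z : ℂ) * (star (mpow z α) * mpow z β) = 0 := by
  obtain ⟨j, hj⟩ := Function.ne_iff.1 h
  obtain ⟨w, hw⟩ := exists_circle_star_pow_mul_pow hj
  set u : Fin d → Circle := Pi.mulSingle j w
  set k : (Fin d → ℂ) → ℂ := fun z => ω z * (star (mpow z α) * mpow z β)
  have hu : ∀ γ, mpow (fun i => (u i : ℂ)) γ = (w : ℂ) ^ γ j := fun γ => by
    rw [← mpow_mulSingle j (w : ℂ) γ]
    congr 1 with i
    exact Pi.apply_mulSingle (fun _ => ((↑) : Circle → ℂ)) (fun _ => Circle.coe_one) j w i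
  have hmpow : ∀ z γ, mpow (fun i => (u i : ℂ) * z i) γ = (w : ℂ) ^ γ j * mpow z γ := fun z γ => by
    rw [← hu, ← mul_mpow]
    rfl
  have hneg : (fun z : Fin d → ℂ => k fun i => (u i : ℂ) * z i) =ᵐ[volume] fun z => -k z := by
    filter_upwards [hω.ae_comp_mul_circle u] with z hz
    simp only [k, hz, hmpow, star_mul', star_pow]
    linear_combination (ω z : ℂ) * (star (mpow z α) * mpow z β) * hw
  have hrot := integral_comp_mul_circle u k
  rw [integral_congr_ae hneg, integral_neg] at hrot
  exact self_eq_neg.1 hrot.symm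

theorem hasSum_integral_mul (hω : IsPolyradial ω t) {ι : Type*} [Countable ι]
    {f : ι → (Fin d → ℂ) → ℂ} {g : (Fin d → ℂ) → ℂ} (hf : ∀ i, Measurable (f i)) {b : ι → ℝ}
    (hb : Summable b) (hfb : ∀ i z, (∀ j, ‖z j‖ ≤ t j) → ‖f i z‖ ≤ b i)
    (hg : ∀ z, HasSum (fun i => f i z) (g z)) :
    HasSum (fun i => ∫ z, (ω z : ℂ) * f i z) (∫ z, (ω z : ℂ) * g z) := by
  refine hasSum_integral_of_dominated_convergence (fun i z => b i * ‖ω z‖)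
    (fun i => hω.integrable.ofReal.1.mul (hf i).aestronglyMeasurable) (fun i => ?_)
    (Filter.Eventually.of_forall fun z => hb.mul_right _) ?_
    (Filter.Eventually.of_forall fun z => (hg z).mul_left _)
  · filter_upwards [hω.support] with z hz
    by_cases h : ∀ j, ‖z j‖ ≤ t j
    · rw [norm_mul, Complex.norm_real, mul_comm]
      exact mul_le_mul_of_nonneg_right (hfb i z h) (norm_nonneg _)
    · simp [hz h]
  · simp_rw [tsum_mul_right]
    exact hω.integrable.norm.const_mul _

variable {a e : (Fin d → ℕ) → ℂ} {A E : (Fin d → ℂ) → ℂ}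

theorem integral_taylorSeries (hω : IsPolyradial ω t) (hA : HasTaylorSeries a A)
    (β : Fin d → ℕ) :
    ∫ z, (ω z : ℂ) * (A (star z) * mpow z β) = a β * radialMoment ω β := by
  have hsum := hω.hasSum_integral_mul (f := fun α z => a α * mpow (star z) α * mpow z β)
    (fun α => (((continuous_mpow α).comp continuous_star).measurable.const_mul _).mul
      (continuous_mpow β).measurable)
    ((hA.summable_norm hω.radii_nonneg).mul_right (mpow t β))
    (fun α z hz => by
      rw [norm_mul, norm_mul, mpow_star, norm_star]
      have := mpow_nonneg hω.radii_nonneg α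
      gcongr
      exacts [norm_mpow_le hz α, norm_mpow_le hz β])
    (fun z => (hA (star z)).mul_right _)
  have hterm : ∀ α, ∫ z, (ω z : ℂ) * (a α * mpow (star z) α * mpow z β) =
      a α * ∫ z, (ω z : ℂ) * (star (mpow z α) * mpow z β) := fun α => by
    rw [← integral_const_mul]
    congr 1 with z
    rw [mpow_star]
    ring
  simp only [hterm] at hsum
  rw [← integral_star_mpow_mul_mpow_self]
  refine hsum.unique (hasSum_single β fun α hα => ?_)
  rw [hω.integral_star_mpow_mul_mpow_of_ne hα, mul_zero]

theorem integral_taylorSeries_mul (hω : IsPolyradial ω t) (hA : HasTaylorSeries a A)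
    (hE : HasTaylorSeries e E) (β : Fin d → ℕ) :
    ∫ z, (ω z : ℂ) * (A (star z) * E z * mpow z β) =
      correlation e (radialMoment ω • a) β := by
  have hsum := hω.hasSum_integral_mul
    (f := fun δ z => A (star z) * (e δ * mpow z δ) * mpow z β)
    (fun δ => ((hA.measurable.comp continuous_star.measurable).mul
      ((continuous_mpow δ).measurable.const_mul _)).mul (continuous_mpow β).measurable)
    (((hE.summable_norm hω.radii_nonneg).mul_left (∑' α, ‖a α‖ * mpow t α)).mul_right (mpow t β))
    (fun δ z hz => by
      have hAz := hA.norm_le hω.radii_nonneg (z := star z) fun j => by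
        rw [Pi.star_apply, norm_star]
        exact hz j
      have hM := (norm_nonneg _).trans hAz
      rw [norm_mul, norm_mul, norm_mul]
      have := mpow_nonneg hω.radii_nonneg δ
      gcongr
      exacts [norm_mpow_le hz δ, norm_mpow_le hz β])
    (fun z => ((hE z).mul_left _).mul_right _)
  rw [← hsum.tsum_eq, correlation]
  refine tsum_congr fun δ => ?_
  rw [Pi.smul_apply', Complex.real_smul, mul_comm (radialMoment ω _ : ℂ),
    ← hω.integral_taylorSeries hA (β + δ), ← integral_const_mul]
  congr 1 with z
  rw [mpow_add]
  ring

theorem norm_mul_norm_mpow_sq_le (hω : IsPolyradial ω t) (α : Fin d → ℕ) :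
    ∀ᵐ z : Fin d → ℂ, ‖ω z * ‖mpow z α‖ ^ 2‖ ≤ ‖ω z‖ * mpow t α ^ 2 := by
  filter_upwards [hω.support] with z hz
  by_cases h : ∀ j, ‖z j‖ ≤ t j
  · rw [norm_mul, norm_pow, norm_norm]
    gcongr
    exact norm_mpow_le h α
  · simp [hz h]

theorem abs_radialMoment_le (hω : IsPolyradial ω t) (α : Fin d → ℕ) :
    |radialMoment ω α| ≤ (∫ z, ‖ω z‖) * mpow t α ^ 2 := by
  rw [← integral_mul_const]
  exact norm_integral_le_of_norm_le (hω.integrable.norm.mul_const _)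
    (hω.norm_mul_norm_mpow_sq_le α)

theorem integrable_mul_norm_mpow_sq (hω : IsPolyradial ω t) (α : Fin d → ℕ) :
    Integrable fun z => ω z * ‖mpow z α‖ ^ 2 :=
  (hω.integrable.norm.mul_const (mpow t α ^ 2)).mono'
    (hω.integrable.1.mul ((continuous_mpow α).norm.pow 2).aestronglyMeasurable)
    (hω.norm_mul_norm_mpow_sq_le α)

end IsPolyradial

/-- The open polyannulus with outer radii `t` and inner radii `t / 2`. -/
def polyannulus (t : Fin d → ℝ) : Set (Fin d → ℂ) :=
  Set.univ.pi fun j => {w | t j / 2 < ‖w‖ ∧ ‖w‖ < t j}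

theorem mem_polyannulus {t : Fin d → ℝ} {z : Fin d → ℂ} :
    z ∈ polyannulus t ↔ ∀ j, t j / 2 < ‖z j‖ ∧ ‖z j‖ < t j := by
  simp only [polyannulus, Set.mem_univ_pi, Set.mem_ofPred_eq]

theorem isOpen_polyannulus (t : Fin d → ℝ) : IsOpen (polyannulus t) :=
  isOpen_set_pi Set.finite_univ fun _ _ =>
    (isOpen_lt continuous_const continuous_norm).inter (isOpen_lt continuous_norm continuous_const)

theorem volume_polyannulus_ne_top (t : Fin d → ℝ) : volume (polyannulus t) ≠ ∞ := by
  have hsub : polyannulus t ⊆ Set.univ.pi fun j => Metric.closedBall (0 : ℂ) (t j) :=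
    Set.pi_mono fun j _ w hw => mem_closedBall_zero_iff.2 hw.2.le
  have hcompact := isCompact_univ_pi fun j => isCompact_closedBall (0 : ℂ) (t j)
  exact ((measure_mono hsub).trans_lt hcompact.measure_lt_top).ne

theorem volume_real_polyannulus_pos {t : Fin d → ℝ} (ht : Pos t) :
    0 < volume.real (polyannulus t) := by
  have hne : (polyannulus t).Nonempty := by
    refine ⟨fun j => ((3 / 4 * t j : ℝ) : ℂ), mem_polyannulus.2 fun j => ?_⟩
    have := ht j
    rw [Complex.norm_real, Real.norm_eq_abs, abs_of_pos (by positivity)]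
    constructor <;> linarith
  exact ENNReal.toReal_pos ((isOpen_polyannulus t).measure_pos volume hne).ne'
    (volume_polyannulus_ne_top t)

theorem IsPolyradial.exists_le_radialMoment {ω : (Fin d → ℂ) → ℝ} {t t₁ : Fin d → ℝ}
    (hω : IsPolyradial ω t) (hω₀ : ∀ᵐ z, 0 ≤ ω z) (ht₁ : Pos t₁) {c : ℝ} (hc : 0 < c)
    (hωc : ∀ᵐ z : Fin d → ℂ, (∀ j, ‖z j‖ < t₁ j) → c ≤ ω z) :
    ∃ C : ℝ, 0 < C ∧ ∀ α, C * mpow (fun j => t₁ j / 2) α ^ 2 ≤ radialMoment ω α := by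
  refine ⟨volume.real (polyannulus t₁) * c, mul_pos (volume_real_polyannulus_pos ht₁) hc,
    fun α => ?_⟩
  have hhalf : (0 : Fin d → ℝ) ≤ fun j => t₁ j / 2 := fun j => (half_pos (ht₁ j)).le
  calc volume.real (polyannulus t₁) * c * mpow (fun j => t₁ j / 2) α ^ 2
      = ∫ z, (polyannulus t₁).indicator (fun _ => c * mpow (fun j => t₁ j / 2) α ^ 2) z := by
        rw [integral_indicator (isOpen_polyannulus t₁).measurableSet, setIntegral_const,
          smul_eq_mul, mul_assoc]
    _ ≤ radialMoment ω α := by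
        refine integral_mono_ae ((integrable_indicator_iff
          (isOpen_polyannulus t₁).measurableSet).2
            (integrableOn_const (volume_polyannulus_ne_top t₁)))
          (hω.integrable_mul_norm_mpow_sq α) ?_
        filter_upwards [hω₀, hωc] with z hz hzc
        refine Set.indicator_apply_le' (fun hmem => ?_) fun _ => mul_nonneg hz (sq_nonneg _)
        rw [mem_polyannulus] at hmem
        rw [norm_mpow]
        gcongr
        · exact hzc fun j => (hmem j).2
        · exact mpow_nonneg hhalf α
        · exact mpow_le_mpow_left hhalf (fun j => (hmem j).1.le) α

end Moments

section Uniqueness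

variable {a b : (Fin d → ℕ) → ℂ} {A : (Fin d → ℂ) → ℂ}

theorem isPolyradial_indicator_closedBall :
    IsPolyradial ((Metric.closedBall (0 : Fin d → ℂ) 1).indicator fun _ => 1) 1 where
  radii_nonneg := Pos.one.nonneg
  integrable := (integrable_indicator_iff Metric.isClosed_closedBall.measurableSet).2
    (integrableOn_const (isCompact_closedBall _ _).measure_lt_top.ne)
  support := Filter.Eventually.of_forall fun z hz => by
    refine Set.indicator_of_notMem (fun hmem => hz fun j => ?_) _
    exact (norm_le_pi_norm z j).trans (mem_closedBall_zero_iff.1 hmem)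
  radial := ⟨(Metric.closedBall (0 : Fin d → ℝ) 1).indicator fun _ => 1,
    Filter.Eventually.of_forall fun z => by
      classical
      simp only [Set.indicator_apply, mem_closedBall_zero_iff, pi_norm_le_iff_of_nonneg zero_le_one,
        norm_norm]⟩

theorem HasTaylorSeries.unique (ha : HasTaylorSeries a A) (hb : HasTaylorSeries b A) : a = b := by
  obtain ⟨C, hC, hle⟩ := isPolyradial_indicator_closedBall.exists_le_radialMoment
    (Filter.Eventually.of_forall fun z => Set.indicator_nonneg (fun _ _ => zero_le_one) z)
    Pos.one one_pos (Filter.Eventually.of_forall fun z hz => by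
      rw [Set.indicator_of_mem (mem_closedBall_zero_iff.2
        ((pi_norm_le_iff_of_nonneg zero_le_one).2 fun j => (hz j).le))])
  ext β
  refine mul_right_cancel₀ (Complex.ofReal_ne_zero.2 ?_)
    ((isPolyradial_indicator_closedBall.integral_taylorSeries ha β).symm.trans
      (isPolyradial_indicator_closedBall.integral_taylorSeries hb β))
  have hpos : Pos fun _ : Fin d => (1 : ℝ) / 2 := fun _ => half_pos one_pos
  exact ((mul_pos hC (pow_pos (hpos.mpow β) 2)).trans_le (hle β)).ne'

theorem hasTaylorSeries_single_zero :
    HasTaylorSeries (Pi.single 0 1 : (Fin d → ℕ) → ℂ) 1 := fun z => by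
  have h := hasSum_single (f := fun α => (Pi.single 0 1 : (Fin d → ℕ) → ℂ) α * mpow z α) 0
    fun α hα => by rw [Pi.single_eq_of_ne hα, zero_mul]
  simpa [mpow] using h

theorem cauchyProd_quadCoeff_neg (ε : ℂ) :
    cauchyProd (quadCoeff ε) (quadCoeff (-ε)) = (Pi.single 0 1 : (Fin d → ℕ) → ℂ) := by
  refine HasTaylorSeries.unique
    ((hasTaylorSeries_quadCoeff ε).mul (hasTaylorSeries_quadCoeff (-ε))) ?_
  convert hasTaylorSeries_single_zero using 1
  ext z
  rw [Pi.mul_apply, ← Complex.exp_add, neg_mul, add_neg_cancel, Complex.exp_zero, Pi.one_apply]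

theorem cauchyProd_cauchyProd_quadCoeff_neg (ha : HasTaylorSeries a A) (ε : ℂ) :
    cauchyProd (cauchyProd a (quadCoeff ε)) (quadCoeff (-ε)) = a := by
  refine HasTaylorSeries.unique
    ((ha.mul (hasTaylorSeries_quadCoeff ε)).mul (hasTaylorSeries_quadCoeff (-ε))) ?_
  convert ha using 1
  ext z
  rw [Pi.mul_apply, Pi.mul_apply, mul_assoc, ← Complex.exp_add, neg_mul, add_neg_cancel,
    Complex.exp_zero, mul_one]

theorem correlation_correlation_quadCoeff_neg {v : (Fin d → ℕ) → ℂ} {C : ℝ} (hv : ∀ α, ‖v α‖ ≤ C)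
    (ε : ℂ) : correlation (quadCoeff ε) (correlation (quadCoeff (-ε)) v) = v := by
  have hsum : ∀ ε, Summable fun α : Fin d → ℕ => ‖quadCoeff ε α‖ := fun ε => by
    simpa only [one_mpow, mul_one] using
      (hasTaylorSeries_quadCoeff ε).summable_norm (Pos.one (d := d)).nonneg
  rw [correlation_correlation fun β => ?_, cauchyProd_quadCoeff_neg, correlation_single_zero]
  refine Summable.of_norm_bounded (((hsum ε).mul_of_nonneg (hsum (-ε)) (fun _ => norm_nonneg _)
    fun _ => norm_nonneg _).mul_right C) fun p => ?_
  rw [norm_mul, norm_mul]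
  gcongr
  exact hv _

end Uniqueness

section Cutoff

variable {χ : (Fin d → ℂ) → ℝ} {t₁ t₂ : Fin d → ℝ} {a : (Fin d → ℕ) → ℂ} {A : (Fin d → ℂ) → ℂ}

/-- The product of `χ` with the Gaussian `e^{-|z|²/4}` that `V_φ^*` contributes to Hermite
coefficients. -/
def gaussianCutoff (χ : (Fin d → ℂ) → ℝ) (z : Fin d → ℂ) : ℝ :=
  χ z * Real.exp (-∑ j, ‖z j‖ ^ 2 / 4)

theorem integrable_of_mem_RClassWith (hχ : χ ∈ RClassWith t₁ t₂) : Integrable χ := by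
  obtain ⟨hbounded, -, hsupport, -, -⟩ := hχ
  have hpolydisc : {z : Fin d → ℂ | ∀ j, ‖z j‖ ≤ t₂ j} =
      Set.univ.pi fun j => Metric.closedBall (0 : ℂ) (t₂ j) := by
    ext z
    simp only [Set.mem_ofPred_eq, Set.mem_univ_pi, mem_closedBall_zero_iff]
  refine integrable_of_memLp_top hbounded (s := {z | ∀ j, ‖z j‖ ≤ t₂ j}) ?_ hsupport
  rw [hpolydisc]
  exact (isCompact_univ_pi fun j => isCompact_closedBall (0 : ℂ) (t₂ j)).measure_lt_top.ne

theorem isPolyradial_gaussianCutoff (hχ : χ ∈ RClassWith t₁ t₂) (ht₂ : 0 ≤ t₂) :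
    IsPolyradial (gaussianCutoff χ) t₂ := by
  have hint := integrable_of_mem_RClassWith hχ
  obtain ⟨-, -, hsupport, ⟨χ₀, hχ₀⟩, -⟩ := hχ
  refine ⟨ht₂, ?_, ?_, fun r => χ₀ r * Real.exp (-∑ j, r j ^ 2 / 4), ?_⟩
  · refine hint.mul_bdd (c := 1) (Continuous.aestronglyMeasurable (by fun_prop))
      (Filter.Eventually.of_forall fun z => ?_)
    rw [Real.norm_of_nonneg (Real.exp_pos _).le]
    exact Real.exp_le_one_iff.2 (neg_nonpos.2 (Finset.sum_nonneg fun j _ => by positivity))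
  · filter_upwards [hsupport] with z hz hout
    rw [gaussianCutoff, hz hout, zero_mul]
  · filter_upwards [hχ₀] with z hz
    rw [gaussianCutoff, hz]

theorem exists_le_radialMoment_gaussianCutoff (hχ : χ ∈ RClassWith t₁ t₂) (ht₁ : Pos t₁)
    (ht₂ : 0 ≤ t₂) :
    ∃ C : ℝ, 0 < C ∧
      ∀ α, C * mpow (fun j => t₁ j / 2) α ^ 2 ≤ radialMoment (gaussianCutoff χ) α := by
  have hpolyradial := isPolyradial_gaussianCutoff hχ ht₂
  obtain ⟨-, hnonneg, -, -, c, hc, hlower⟩ := hχ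
  refine hpolyradial.exists_le_radialMoment ?_ ht₁
    (mul_pos hc (Real.exp_pos (-∑ j, t₁ j ^ 2 / 4))) ?_
  · filter_upwards [hnonneg] with z hz
    exact mul_nonneg hz (Real.exp_pos _).le
  · filter_upwards [hlower] with z hz hlt
    refine mul_le_mul (hz hlt) (Real.exp_le_exp.2 (neg_le_neg ?_)) (Real.exp_pos _).le
      (hc.le.trans (hz hlt))
    refine Finset.sum_le_sum fun j _ => ?_
    have := (hlt j).le
    gcongr

theorem radialMoment_gaussianCutoff_pos (hχ : χ ∈ RClass d) (α : Fin d → ℕ) :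
    0 < radialMoment (gaussianCutoff χ) α := by
  obtain ⟨t₁, t₂, ht₁, ht₂, -, hχ⟩ := hχ
  obtain ⟨C, hC, hle⟩ := exists_le_radialMoment_gaussianCutoff hχ ht₁ ht₂.nonneg
  have hhalf : Pos fun j => t₁ j / 2 := fun j => half_pos (ht₁ j)
  exact (mul_pos hC (pow_pos (hhalf.mpow α) 2)).trans_le (hle α)

theorem hasFactorialDecay_radialMoment (hχ : χ ∈ RClass d) :
    HasFactorialDecay 0 (radialMoment (gaussianCutoff χ)) := by
  obtain ⟨t₁, t₂, -, ht₂, -, hχ⟩ := hχ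
  refine ⟨t₂ * t₂, ht₂.mul ht₂, ∫ z, ‖gaussianCutoff χ z‖, fun α => ?_⟩
  rw [factorialWeight_zero, mul_mpow, ← sq]
  exact (isPolyradial_gaussianCutoff hχ ht₂.nonneg).abs_radialMoment_le α

theorem hasFactorialDecay_inv_radialMoment (hχ : χ ∈ RClass d) :
    HasFactorialDecay 0 (radialMoment (gaussianCutoff χ))⁻¹ := by
  have hpos := radialMoment_gaussianCutoff_pos hχ
  obtain ⟨t₁, t₂, ht₁, ht₂, -, hχ⟩ := hχ
  obtain ⟨C, hC, hle⟩ := exists_le_radialMoment_gaussianCutoff hχ ht₁ ht₂.nonneg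
  have hhalf : Pos fun j => t₁ j / 2 := fun j => half_pos (ht₁ j)
  refine ⟨_, hhalf.inv.mul hhalf.inv, C⁻¹, fun α => ?_⟩
  rw [Pi.inv_apply, abs_of_pos (inv_pos.2 (hpos α)), factorialWeight_zero, mul_mpow, ← sq,
    eq_inv_of_mul_eq_one_left (mpow_inv_mul_mpow hhalf α), inv_pow, ← mul_inv]
  exact inv_anti₀ (mul_pos hC (pow_pos (hhalf.mpow α) 2)) (hle α)

theorem norm_complexEquiv_sq (p : (Fin d → ℝ) × (Fin d → ℝ)) (j : Fin d) :
    ‖complexEquiv d p j‖ ^ 2 = p.1 j ^ 2 + p.2 j ^ 2 := by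
  rw [complexEquiv_apply, mul_comm, Complex.sq_norm, Complex.normSq_add_mul_I]

theorem cutoff_eq (θ : ℝ) (χ : (Fin d → ℂ) → ℝ) (A : (Fin d → ℂ) → ℂ)
    (p : (Fin d → ℝ) × (Fin d → ℝ)) :
    cutoff θ χ A p = A (star (complexEquiv d p)) *
      Complex.exp (-(Complex.I * (θ : ℂ) * (dot p.1 p.2 : ℂ))) * (χ (complexEquiv d p) : ℂ) := by
  have hstar : star (complexEquiv d p) = fun j => (p.1 j : ℂ) - Complex.I * p.2 j := by
    ext j
    rw [Pi.star_apply, complexEquiv_apply, Complex.star_def, map_add, map_mul, Complex.conj_I,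
      Complex.conj_ofReal, Complex.conj_ofReal, neg_mul, sub_eq_add_neg]
  rw [cutoff, hstar, ← funext (complexEquiv_apply p)]

theorem norm_exp_neg_I_mul_dot (θ : ℝ) (x ξ : Fin d → ℝ) :
    ‖Complex.exp (-(Complex.I * (θ : ℂ) * (dot x ξ : ℂ)))‖ = 1 := by
  rw [mul_assoc, mul_comm, ← neg_mul, ← Complex.ofReal_mul, ← Complex.ofReal_neg,
    Complex.norm_exp_ofReal_mul_I]

theorem ae_norm_cutoff_le (hχ : χ ∈ RClassWith t₁ t₂) (ht₂ : 0 ≤ t₂) (θ : ℝ)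
    (hA : HasTaylorSeries a A) :
    ∀ᵐ p, ‖cutoff θ χ A p‖ ≤ (∑' α, ‖a α‖ * mpow t₂ α) * ‖χ (complexEquiv d p)‖ := by
  obtain ⟨-, -, hsupport, -, -⟩ := hχ
  filter_upwards [measurePreserving_complexEquiv.quasiMeasurePreserving.ae hsupport] with p hp
  rw [cutoff_eq, norm_mul, norm_mul, norm_exp_neg_I_mul_dot, mul_one, Complex.norm_real]
  by_cases h : ∀ j, ‖complexEquiv d p j‖ ≤ t₂ j
  · refine mul_le_mul_of_nonneg_right (hA.norm_le ht₂ fun j => ?_) (norm_nonneg _)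
    rw [Pi.star_apply, norm_star]
    exact h j
  · rw [hp h, norm_zero, mul_zero, mul_zero]

theorem memLp_cutoff (hχ : χ ∈ RClassWith t₁ t₂) (ht₂ : 0 ≤ t₂) (θ : ℝ)
    (hA : HasTaylorSeries a A) : MemLp (cutoff θ χ A) ∞ := by
  have hχ' : MemLp (fun p => χ (complexEquiv d p)) ∞ :=
    hχ.1.comp_measurePreserving measurePreserving_complexEquiv
  refine hχ'.of_le_mul ?_ (ae_norm_cutoff_le hχ ht₂ θ hA)
  have hA' : Measurable fun p => A (star (complexEquiv d p)) :=
    hA.measurable.comp (continuous_star.measurable.comp (complexEquiv d).measurable)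
  have hphase : Continuous fun p : (Fin d → ℝ) × (Fin d → ℝ) =>
      Complex.exp (-(Complex.I * (θ : ℂ) * (dot p.1 p.2 : ℂ))) := by
    unfold dot
    fun_prop
  rw [funext (cutoff_eq θ χ A)]
  exact (hA'.aestronglyMeasurable.mul hphase.aestronglyMeasurable).mul
    (Complex.continuous_ofReal.comp_aestronglyMeasurable hχ'.1)

theorem isBoundedCompact_cutoff (hχ : χ ∈ RClassWith t₁ t₂) (ht₂ : 0 ≤ t₂) (θ : ℝ)
    (hA : HasTaylorSeries a A) : IsBoundedCompact (cutoff θ χ A) := by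
  refine ⟨memLp_cutoff hχ ht₂ θ hA, Set.Icc (-t₂) t₂ ×ˢ Set.Icc (-t₂) t₂,
    isCompact_Icc.prod isCompact_Icc, ?_⟩
  obtain ⟨-, -, hsupport, -, -⟩ := hχ
  filter_upwards [measurePreserving_complexEquiv.quasiMeasurePreserving.ae hsupport] with p hp hK
  have hout : ¬ ∀ j, ‖complexEquiv d p j‖ ≤ t₂ j := fun h => by
    have hsq : ∀ j, p.1 j ^ 2 + p.2 j ^ 2 ≤ t₂ j ^ 2 := fun j => by
      rw [← norm_complexEquiv_sq]
      exact pow_le_pow_left₀ (norm_nonneg _) (h j) 2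
    have hfst : ∀ j, -t₂ j ≤ p.1 j ∧ p.1 j ≤ t₂ j := fun j =>
      abs_le_of_sq_le_sq' ((le_add_of_nonneg_right (sq_nonneg _)).trans (hsq j)) (ht₂ j)
    have hsnd : ∀ j, -t₂ j ≤ p.2 j ∧ p.2 j ≤ t₂ j := fun j =>
      abs_le_of_sq_le_sq' ((le_add_of_nonneg_left (sq_nonneg _)).trans (hsq j)) (ht₂ j)
    exact hK ⟨⟨fun j => (hfst j).1, fun j => (hfst j).2⟩, fun j => (hsnd j).1, fun j => (hsnd j).2⟩
  rw [cutoff_eq, hp hout, Complex.ofReal_zero, mul_zero]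

end Cutoff

section RepresentationMap

variable {χ : (Fin d → ℂ) → ℝ} {a v : (Fin d → ℕ) → ℂ}
  {A : (Fin d → ℂ) → ℂ} {S : Set ((Fin d → ℕ) → ℂ)}

/-- The constant `ε` for which `e^{-i(θ - 1/2)⟨x, ξ⟩} = e^{ε⟨z̄, z̄⟩} e^{-ε⟨z, z⟩}` with
`z = x + iξ`. -/
def twist (θ : ℝ) : ℂ := (θ - 1 / 2) / 4

theorem twist_half : twist (1 / 2) = 0 := by
  norm_num [twist]

theorem exp_mul_exp_eq_twist (θ : ℝ) (p : (Fin d → ℝ) × (Fin d → ℝ)) :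
    Complex.exp (-(Complex.I * (θ : ℂ) * (dot p.1 p.2 : ℂ))) *
        Complex.exp (Complex.I * (dot p.1 p.2 : ℂ) / 2 -
          ∑ j, ((p.1 j : ℂ) ^ 2 + (p.2 j : ℂ) ^ 2) / 4) =
      Complex.exp (twist θ * ∑ j, star (complexEquiv d p) j ^ 2) *
        Complex.exp (-twist θ * ∑ j, complexEquiv d p j ^ 2) *
        Real.exp (-∑ j, ‖complexEquiv d p j‖ ^ 2 / 4) := by
  simp only [norm_complexEquiv_sq]
  push_cast
  simp only [← Complex.exp_add, dot, Complex.ofReal_sum, Finset.mul_sum, Finset.sum_div,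
    ← Finset.sum_neg_distrib, ← Finset.sum_add_distrib, ← Finset.sum_sub_distrib]
  congr 1
  refine Finset.sum_congr rfl fun j _ => ?_
  rw [Pi.star_apply, complexEquiv_apply, Complex.star_def, twist]
  simp only [map_add, map_mul, Complex.conj_I, Complex.conj_ofReal, Complex.ofReal_mul]
  ring_nf

/-- The effect of `F₀ ↦ V_φ^* F`, where `F(x, ξ) = F₀(x - iξ) e^{-iθ⟨x, ξ⟩} χ(x, ξ)`, on Taylor
coefficients of `F₀` and rescaled Hermite coefficients. -/
def representationMap (θ : ℝ) (χ : (Fin d → ℂ) → ℝ) (a : (Fin d → ℕ) → ℂ) : (Fin d → ℕ) → ℂ :=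
  correlation (quadCoeff (-twist θ))
    (radialMoment (gaussianCutoff χ) • cauchyProd a (quadCoeff (twist θ)))

theorem representationMap_half (χ : (Fin d → ℂ) → ℝ) (a : (Fin d → ℕ) → ℂ) :
    representationMap (1 / 2) χ a = radialMoment (gaussianCutoff χ) • a := by
  rw [representationMap, twist_half, neg_zero, quadCoeff_zero, cauchyProd_single_zero,
    correlation_single_zero]

theorem hermiteScale_smul_hermiteCoeff_stftAdjoint_cutoff (hχ : χ ∈ RClass d) (θ : ℝ)
    (hA : HasTaylorSeries a A) :
    hermiteScale d • hermiteCoeff (stftAdjoint (cutoff θ χ A)) = representationMap θ χ a := by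
  obtain ⟨t₁, t₂, -, ht₂, -, hχ⟩ := hχ
  ext β
  rw [Pi.smul_apply', Complex.real_smul,
    hermiteCoeff_stftAdjoint (isBoundedCompact_cutoff hχ ht₂.nonneg θ hA).integrable,
    representationMap, ← (isPolyradial_gaussianCutoff hχ ht₂.nonneg).integral_taylorSeries_mul
      (hA.mul (hasTaylorSeries_quadCoeff (twist θ))) (hasTaylorSeries_quadCoeff (-twist θ)) β,
    ← measurePreserving_complexEquiv.integral_comp (complexEquiv d).measurableEmbedding]
  congr 1 with p
  rw [cutoff_eq, ← funext (complexEquiv_apply p), gaussianCutoff, Pi.mul_apply, Complex.ofReal_mul]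
  linear_combination A (star (complexEquiv d p)) * (χ (complexEquiv d p) : ℂ) *
    mpow (complexEquiv d p) β * exp_mul_exp_eq_twist θ p

theorem IsEntireClass.radialMoment_smul_mem (hS : IsEntireClass S) (hχ : χ ∈ RClass d)
    (hv : v ∈ S) : radialMoment (gaussianCutoff χ) • v ∈ S :=
  hS.smul_mem v hv _ (hasFactorialDecay_radialMoment hχ)

theorem IsEntireClass.exists_radialMoment_smul_eq (hS : IsEntireClass S) (hχ : χ ∈ RClass d)
    (hv : v ∈ S) : ∃ a ∈ S, radialMoment (gaussianCutoff χ) • a = v :=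
  ⟨_, hS.smul_mem v hv _ (hasFactorialDecay_inv_radialMoment hχ),
    smul_inv_smul_of_ne_zero (fun α => (radialMoment_gaussianCutoff_pos hχ α).ne') v⟩

theorem IsEntireClass.image_representationMap_half (hS : IsEntireClass S) (hχ : χ ∈ RClass d) :
    representationMap (1 / 2) χ '' S = S := by
  simp only [funext (representationMap_half χ)]
  exact (Set.image_subset_iff.2 fun a ha => hS.radialMoment_smul_mem hχ ha).antisymm
    fun v hv => hS.exists_radialMoment_smul_eq hχ hv

theorem IsGaussianClass.image_representationMap (hS : IsGaussianClass S) (hχ : χ ∈ RClass d)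
    (θ : ℝ) : representationMap θ χ '' S = S := by
  refine (Set.image_subset_iff.2 fun a ha => ?_).antisymm fun v hv => ?_
  · exact hS.correlation_mem _ (hS.radialMoment_smul_mem hχ (hS.cauchyProd_mem a ha _)) _
  · obtain ⟨b, hb, hbv⟩ := hS.exists_radialMoment_smul_eq hχ (hS.correlation_mem v hv (twist θ))
    obtain ⟨B, hB⟩ := hS.exists_hasTaylorSeries hb
    obtain ⟨C, hC⟩ := hS.bounded v hv
    have hcauchyProd := cauchyProd_cauchyProd_quadCoeff_neg hB (-twist θ)
    have hcorrelation := correlation_correlation_quadCoeff_neg hC (-twist θ)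
    rw [neg_neg] at hcauchyProd hcorrelation
    refine ⟨_, hS.cauchyProd_mem b hb (-twist θ), ?_⟩
    rw [representationMap, hcauchyProd, hbv, hcorrelation]

end RepresentationMap

section Representation

variable {χ : (Fin d → ℂ) → ℝ} {c : (Fin d → ℕ) → ℂ} {A : (Fin d → ℂ) → ℂ}
  {S : Set ((Fin d → ℕ) → ℂ)} {f : (Fin d → ℝ) → ℂ} {θ : ℝ}

/-- The factor `(α!)^{-1/2}` turning the coefficients of a power series with respect to the
normalized monomials into its Taylor coefficients. -/
def taylorScale (d : ℕ) (α : Fin d → ℕ) : ℝ := (√(multiFactorial α : ℝ))⁻¹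

theorem taylorScale_eq : taylorScale d = factorialWeight (1 / 2) 1 := by
  ext α
  rw [taylorScale, factorialWeight, one_mpow, one_mul, Real.rpow_neg (Nat.cast_nonneg _),
    Real.sqrt_eq_rpow]

theorem taylorScale_ne_zero (α : Fin d → ℕ) : taylorScale d α ≠ 0 :=
  inv_ne_zero (sqrt_multiFactorial_pos α).ne'

theorem hermiteScale_eq : hermiteScale d = factorialWeight (-(1 / 2)) fun _ => √2 := by
  ext α
  rw [hermiteScale, factorialWeight, neg_neg, Real.sqrt_eq_rpow (multiFactorial α : ℝ)]

theorem hermiteScale_ne_zero (α : Fin d → ℕ) : hermiteScale d α ≠ 0 := by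
  rw [hermiteScale_eq]
  exact (factorialWeight_pos _ Pos.sqrt_two α).ne'

theorem isSum_iff_hasTaylorSeries : IsSum c A ↔ HasTaylorSeries (taylorScale d • c) A := by
  have hterm : ∀ z α, c α * monomial α z = (taylorScale d • c) α * mpow z α := fun z α => by
    rw [monomial, Pi.smul_apply', Complex.real_smul, taylorScale, mpow, Complex.ofReal_inv]
    ring
  simp only [IsSum, HasTaylorSeries, hterm]

theorem stftAdjoint_congr {F G : (Fin d → ℝ) × (Fin d → ℝ) → ℂ} (h : F =ᵐ[volume] G) :
    stftAdjoint F = stftAdjoint G :=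
  funext fun x => integral_congr_ae (h.mono fun p hp => by simp only [hp])

theorem ae_eq_of_hermiteCoeff_eq {g : (Fin d → ℝ) → ℂ} (hf : MemLp f 2) (hg : MemLp g 2)
    (h : hermiteCoeff f = hermiteCoeff g) : f =ᵐ[volume] g := by
  have hsub : hermiteCoeff (f - g) = 0 := by rw [hermiteCoeff_sub hf hg, h, sub_self]
  exact (ae_eq_zero_of_hermiteCoeff_eq_zero (hf.sub hg) hsub).mono fun x hx => sub_eq_zero.1 hx

theorem hasRepresentation_iff_exists_taylorSeries (hχ : χ ∈ RClass d) :
    HasRepresentation θ χ {c | taylorScale d • c ∈ S} f ↔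
      ∃ a ∈ S, ∃ A, HasTaylorSeries a A ∧ f =ᵐ[volume] stftAdjoint (cutoff θ χ A) := by
  constructor
  · rintro ⟨F, -, ⟨c, hc, A, hA, hF⟩, hf⟩
    exact ⟨_, hc, A, isSum_iff_hasTaylorSeries.1 hA, stftAdjoint_congr hF ▸ hf⟩
  · rintro ⟨a, ha, A, hA, hf⟩
    obtain ⟨t₁, t₂, -, ht₂, -, hχ⟩ := hχ
    have hscale := smul_inv_smul_of_ne_zero taylorScale_ne_zero a
    refine ⟨_, isBoundedCompact_cutoff hχ ht₂.nonneg θ hA, ⟨(taylorScale d)⁻¹ • a, ?_, A, ?_,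
      Filter.EventuallyEq.rfl⟩, hf⟩
    · rwa [Set.mem_ofPred_eq, hscale]
    · rwa [isSum_iff_hasTaylorSeries, hscale]

theorem hasRepresentation_iff_of_image_eq (hχ : χ ∈ RClass d) (hS : IsEntireClass S)
    (himage : representationMap θ χ '' S = S) :
    HasRepresentation θ χ {c | taylorScale d • c ∈ S} f ↔
      MemLp f 2 ∧ hermiteScale d • hermiteCoeff f ∈ S := by
  have hcoeff : ∀ {a A}, HasTaylorSeries a A →
      hermiteScale d • hermiteCoeff (stftAdjoint (cutoff θ χ A)) = representationMap θ χ a :=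
    hermiteScale_smul_hermiteCoeff_stftAdjoint_cutoff hχ θ
  have hmemLp : ∀ {a A}, HasTaylorSeries a A → MemLp (stftAdjoint (cutoff θ χ A)) 2 := by
    obtain ⟨t₁, t₂, -, ht₂, -, hχ⟩ := hχ
    exact fun hA => memLp_stftAdjoint (isBoundedCompact_cutoff hχ ht₂.nonneg θ hA).integrable
  rw [hasRepresentation_iff_exists_taylorSeries hχ]
  constructor
  · rintro ⟨a, ha, A, hA, hf⟩
    refine ⟨(hmemLp hA).ae_eq hf.symm, ?_⟩
    rw [hermiteCoeff_congr hf, hcoeff hA, ← himage]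
    exact Set.mem_image_of_mem _ ha
  · rintro ⟨hf, hfS⟩
    rw [← himage] at hfS
    obtain ⟨a, ha, hfa⟩ := hfS
    obtain ⟨A, hA⟩ := hS.exists_hasTaylorSeries ha
    refine ⟨a, ha, A, hA, ae_eq_of_hermiteCoeff_eq hf (hmemLp hA) ?_⟩
    rw [← inv_smul_smul_of_ne_zero hermiteScale_ne_zero (hermiteCoeff f), ← hfa, ← hcoeff hA,
      inv_smul_smul_of_ne_zero hermiteScale_ne_zero]

end Representation

section PilipovicSpaces

variable {χ : (Fin d → ℂ) → ℝ} {f : (Fin d → ℝ) → ℂ} {θ κ p σ s : ℝ}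
  {w wH wA : (Fin d → ℝ) → (Fin d → ℕ) → ℝ}

theorem isScaling_hermiteScale (κ : ℝ) :
    IsScaling (hermiteScale d) (factorialWeight κ) (factorialWeight (κ - 1 / 2)) := by
  rw [hermiteScale_eq, ← neg_add_eq_sub]
  exact isScaling_factorialWeight _ κ Pos.sqrt_two

theorem isScaling_taylorScale (κ : ℝ) :
    IsScaling (taylorScale d) (factorialWeight (κ - 1)) (factorialWeight (κ - 1 / 2)) := by
  rw [taylorScale_eq, show κ - 1 / 2 = 1 / 2 + (κ - 1) by ring]
  exact isScaling_factorialWeight _ (κ - 1) Pos.one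

theorem isScaling_hermiteScale_expWeight (hp : 1 < p) :
    IsScaling (hermiteScale d) (expWeight p) (expWeight p) := by
  rw [hermiteScale_eq]
  exact isScaling_factorialWeight_expWeight (by norm_num [abs_neg]) hp Pos.sqrt_two

theorem isScaling_taylorScale_expWeight (hp : 1 < p) :
    IsScaling (taylorScale d) (expWeight p) (expWeight p) := by
  rw [taylorScale_eq]
  exact isScaling_factorialWeight_expWeight (by norm_num) hp Pos.one

theorem hasRepresentation_roumieuClass_iff (hχ : χ ∈ RClass d)
    (hH : IsScaling (hermiteScale d) wH w) (hA : IsScaling (taylorScale d) wA w)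
    (hS : IsEntireClass (roumieuClass w))
    (himage : representationMap θ χ '' roumieuClass w = roumieuClass w) :
    HasRepresentation θ χ (roumieuClass wA) f ↔ MemLp f 2 ∧ hermiteCoeff f ∈ roumieuClass wH := by
  rw [← hH.smul_mem_roumieuClass_iff, ← hasRepresentation_iff_of_image_eq hχ hS himage]
  simp only [hA.smul_mem_roumieuClass_iff, Set.ofPred_mem_eq]

theorem hasRepresentation_beurlingClass_iff (hχ : χ ∈ RClass d)
    (hH : IsScaling (hermiteScale d) wH w) (hA : IsScaling (taylorScale d) wA w)
    (hS : IsEntireClass (beurlingClass w))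
    (himage : representationMap θ χ '' beurlingClass w = beurlingClass w) :
    HasRepresentation θ χ (beurlingClass wA) f ↔
      MemLp f 2 ∧ hermiteCoeff f ∈ beurlingClass wH := by
  rw [← hH.smul_mem_beurlingClass_iff, ← hasRepresentation_iff_of_image_eq hχ hS himage]
  simp only [hA.smul_mem_beurlingClass_iff, Set.ofPred_mem_eq]

theorem one_lt_one_div_two_mul (hs : 0 < s) (hs' : s < 1 / 2) : 1 < 1 / (2 * s) := by
  rw [lt_one_div one_pos (by positivity)]
  linarith

theorem one_div_two_mul_sub_half_pos (hσ : 0 < σ) (hσ1 : σ < 1) : 0 < 1 / (2 * σ) - 1 / 2 := by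
  rw [sub_pos, one_div_lt_one_div two_pos (by positivity)]
  linarith

theorem mem_H_flat_iff_of_image_eq (hχ : χ ∈ RClass d) (hσ : 0 < σ) (hσ1 : σ < 1)
    (himage : representationMap θ χ '' roumieuClass (factorialWeight (1 / (2 * σ) - 1 / 2)) =
      roumieuClass (factorialWeight (1 / (2 * σ) - 1 / 2))) :
    f ∈ H d (.flat σ) ↔
      HasRepresentation θ χ (roumieuClass (factorialWeight (1 / (2 * σ) - 1))) f :=
  (hasRepresentation_roumieuClass_iff hχ (isScaling_hermiteScale _) (isScaling_taylorScale _)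
    (isEntireFamily_factorialWeight
      (one_div_two_mul_sub_half_pos hσ hσ1)).isEntireClass_roumieuClass himage).symm

theorem mem_H₀_flat_iff_of_image_eq (hχ : χ ∈ RClass d) (hσ : 0 < σ) (hσ1 : σ < 1)
    (himage : representationMap θ χ '' beurlingClass (factorialWeight (1 / (2 * σ) - 1 / 2)) =
      beurlingClass (factorialWeight (1 / (2 * σ) - 1 / 2))) :
    f ∈ H₀ d (.flat σ) ↔
      HasRepresentation θ χ (beurlingClass (factorialWeight (1 / (2 * σ) - 1))) f :=
  (hasRepresentation_beurlingClass_iff hχ (isScaling_hermiteScale _) (isScaling_taylorScale _)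
    (isEntireFamily_factorialWeight
      (one_div_two_mul_sub_half_pos hσ hσ1)).isEntireClass_beurlingClass himage).symm

theorem mem_H_flat_iff (hχ : χ ∈ RClass d) (hσ : 1 / 2 ≤ σ) (hσ1 : σ < 1) (θ : ℝ) :
    f ∈ H d (.flat σ) ↔
      HasRepresentation θ χ (roumieuClass (factorialWeight (1 / (2 * σ) - 1))) f := by
  have hσ0 : 0 < σ := one_half_pos.trans_le hσ
  have hκ : 1 / (2 * σ) - 1 / 2 ≤ 1 / 2 := by
    rw [sub_le_iff_le_add, add_halves, div_le_one (by positivity)]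
    linarith
  exact mem_H_flat_iff_of_image_eq hχ hσ0 hσ1 ((isGaussianClass_roumieuClass
    (one_div_two_mul_sub_half_pos hσ0 hσ1) hκ).image_representationMap hχ θ)

theorem mem_H₀_flat_iff (hχ : χ ∈ RClass d) (hσ : 1 / 2 < σ) (hσ1 : σ < 1) (θ : ℝ) :
    f ∈ H₀ d (.flat σ) ↔
      HasRepresentation θ χ (beurlingClass (factorialWeight (1 / (2 * σ) - 1))) f := by
  have hσ0 : 0 < σ := one_half_pos.trans hσ
  have hκ : 1 / (2 * σ) - 1 / 2 < 1 / 2 := by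
    rw [sub_lt_iff_lt_add, add_halves, div_lt_one (by positivity)]
    linarith
  exact mem_H₀_flat_iff_of_image_eq hχ hσ0 hσ1 ((isGaussianClass_beurlingClass
    (one_div_two_mul_sub_half_pos hσ0 hσ1) hκ).image_representationMap hχ θ)

theorem mem_H_flat_iff_half (hχ : χ ∈ RClass d) (hσ : 0 < σ) (hσ1 : σ < 1) :
    f ∈ H d (.flat σ) ↔
      HasRepresentation (1 / 2) χ (roumieuClass (factorialWeight (1 / (2 * σ) - 1))) f :=
  mem_H_flat_iff_of_image_eq hχ hσ hσ1 ((isEntireFamily_factorialWeight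
    (one_div_two_mul_sub_half_pos hσ hσ1)).isEntireClass_roumieuClass.image_representationMap_half
      hχ)

theorem mem_H₀_flat_iff_half (hχ : χ ∈ RClass d) (hσ : 0 < σ) (hσ1 : σ < 1) :
    f ∈ H₀ d (.flat σ) ↔
      HasRepresentation (1 / 2) χ (beurlingClass (factorialWeight (1 / (2 * σ) - 1))) f :=
  mem_H₀_flat_iff_of_image_eq hχ hσ hσ1 ((isEntireFamily_factorialWeight
    (one_div_two_mul_sub_half_pos hσ hσ1)).isEntireClass_beurlingClass.image_representationMap_half
      hχ)

theorem weight_real (hs : s ≠ 1 / 2) :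
    (fun r : Fin d → ℝ => weight r (.real s)) = expWeight (1 / (2 * s)) := by
  ext r α
  rw [weight, if_neg hs, expWeight]

theorem mem_H_real_iff (hχ : χ ∈ RClass d) (hs : 0 < s) (hs' : s < 1 / 2) :
    f ∈ H d (.real s) ↔ HasRepresentation (1 / 2) χ (A d (.real s)) f := by
  have hp := one_lt_one_div_two_mul hs hs'
  have hS := (isEntireFamily_expWeight (d := d) hp).isEntireClass_roumieuClass
  have h := hasRepresentation_roumieuClass_iff (f := f) hχ (isScaling_hermiteScale_expWeight hp)
    (isScaling_taylorScale_expWeight hp) hS (hS.image_representationMap_half hχ)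
  rw [← weight_real hs'.ne] at h
  exact h.symm

theorem mem_H₀_real_iff (hχ : χ ∈ RClass d) (hs : 0 < s) (hs' : s < 1 / 2) :
    f ∈ H₀ d (.real s) ↔ HasRepresentation (1 / 2) χ (A₀ d (.real s)) f := by
  have hp := one_lt_one_div_two_mul hs hs'
  have hS := (isEntireFamily_expWeight (d := d) hp).isEntireClass_beurlingClass
  have h := hasRepresentation_beurlingClass_iff (f := f) hχ (isScaling_hermiteScale_expWeight hp)
    (isScaling_taylorScale_expWeight hp) hS (hS.image_representationMap_half hχ)
  rw [← weight_real hs'.ne] at h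
  exact h.symm

theorem weight_flat (hσ : 0 < σ) (hσ' : σ < 1 / 2) :
    (fun r : Fin d → ℝ => weight r (.flat (σ / (1 - 2 * σ)))) =
      factorialWeight (1 / (2 * σ) - 1) := by
  have : 1 - 2 * σ ≠ 0 := by linarith
  have hexponent : 1 / (2 * (σ / (1 - 2 * σ))) = 1 / (2 * σ) - 1 := by field_simp
  rw [← hexponent]
  rfl

theorem dualWeight_flat (hσ : 1 / 2 < σ) :
    (fun r : Fin d → ℝ => dualWeight r (.flat (σ / (2 * σ - 1)))) =
      factorialWeight (1 / (2 * σ) - 1) := by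
  have : σ ≠ 0 := by linarith
  have : 2 * σ - 1 ≠ 0 := by linarith
  have hexponent : 1 / (2 * (σ / (2 * σ - 1))) = -(1 / (2 * σ) - 1) := by
    field_simp
    ring
  ext r α
  rw [dualWeight, hexponent]
  rfl

theorem weight_real_half :
    (fun r : Fin d → ℝ => weight r (.real (1 / 2))) = factorialWeight (1 / (2 * (1 / 2)) - 1) := by
  rw [show (1 / (2 * (1 / 2)) - 1 : ℝ) = 0 by norm_num]
  ext r α
  rw [weight, if_pos rfl, factorialWeight_zero, mpow]

theorem dualWeight_real_half :
    (fun r : Fin d → ℝ => dualWeight r (.real (1 / 2))) =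
      factorialWeight (1 / (2 * (1 / 2)) - 1) := by
  rw [← weight_real_half]
  ext r α
  rw [dualWeight, weight, if_pos rfl, if_pos rfl]

theorem A_flat_eq (hσ : 0 < σ) (hσ' : σ < 1 / 2) :
    A d (.flat (σ / (1 - 2 * σ))) = roumieuClass (factorialWeight (1 / (2 * σ) - 1)) :=
  congrArg roumieuClass (weight_flat hσ hσ')

theorem A₀_flat_eq (hσ : 0 < σ) (hσ' : σ < 1 / 2) :
    A₀ d (.flat (σ / (1 - 2 * σ))) = beurlingClass (factorialWeight (1 / (2 * σ) - 1)) :=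
  congrArg beurlingClass (weight_flat hσ hσ')

theorem A₀Dual_flat_eq (hσ : 1 / 2 < σ) :
    A₀Dual d (.flat (σ / (2 * σ - 1))) = roumieuClass (factorialWeight (1 / (2 * σ) - 1)) :=
  congrArg roumieuClass (dualWeight_flat hσ)

theorem ADual_flat_eq (hσ : 1 / 2 < σ) :
    ADual d (.flat (σ / (2 * σ - 1))) = beurlingClass (factorialWeight (1 / (2 * σ) - 1)) :=
  congrArg beurlingClass (dualWeight_flat hσ)

theorem A₀Dual_real_half_eq :
    A₀Dual d (.real (1 / 2)) = roumieuClass (factorialWeight (1 / (2 * (1 / 2)) - 1)) :=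
  congrArg roumieuClass dualWeight_real_half

theorem A₀_real_half_eq :
    A₀ d (.real (1 / 2)) = beurlingClass (factorialWeight (1 / (2 * (1 / 2)) - 1)) :=
  congrArg beurlingClass weight_real_half

end PilipovicSpaces

end Pilipovic

end

theorem mainTheorem12_general (d : ℕ) (χ : (Fin d → ℂ) → ℝ) (hχ : χ ∈ Pilipovic.RClass d)
    (f : (Fin d → ℝ) → ℂ) :
    (∀ σ : ℝ, 1 / 2 < σ → σ < 1 → ∀ θ : ℝ,
      (f ∈ Pilipovic.H d (.flat σ) ↔
        Pilipovic.HasRepresentation θ χ (Pilipovic.A₀Dual d (.flat (σ / (2 * σ - 1)))) f) ∧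
      (f ∈ Pilipovic.H₀ d (.flat σ) ↔
        Pilipovic.HasRepresentation θ χ (Pilipovic.ADual d (.flat (σ / (2 * σ - 1)))) f)) ∧
    (∀ θ : ℝ,
      (f ∈ Pilipovic.H d (.flat (1 / 2)) ↔
        Pilipovic.HasRepresentation θ χ (Pilipovic.A₀Dual d (.real (1 / 2))) f)) ∧
    (f ∈ Pilipovic.H₀ d (.flat (1 / 2)) ↔
      Pilipovic.HasRepresentation (1 / 2) χ (Pilipovic.A₀ d (.real (1 / 2))) f) ∧
    (∀ σ : ℝ, 0 < σ → σ < 1 / 2 →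
      (f ∈ Pilipovic.H d (.flat σ) ↔
        Pilipovic.HasRepresentation (1 / 2) χ (Pilipovic.A d (.flat (σ / (1 - 2 * σ)))) f) ∧
      (f ∈ Pilipovic.H₀ d (.flat σ) ↔
        Pilipovic.HasRepresentation (1 / 2) χ (Pilipovic.A₀ d (.flat (σ / (1 - 2 * σ)))) f)) ∧
    (∀ s : ℝ, 0 < s → s < 1 / 2 →
      (f ∈ Pilipovic.H d (.real s) ↔
        Pilipovic.HasRepresentation (1 / 2) χ (Pilipovic.A d (.real s)) f) ∧
      (f ∈ Pilipovic.H₀ d (.real s) ↔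
        Pilipovic.HasRepresentation (1 / 2) χ (Pilipovic.A₀ d (.real s)) f)) := by
  refine ⟨fun σ hσ hσ1 θ => ⟨?_, ?_⟩, fun θ => ?_, ?_, fun σ hσ hσ' => ⟨?_, ?_⟩,
    fun s hs hs' => ⟨?_, ?_⟩⟩
  · rw [Pilipovic.A₀Dual_flat_eq hσ]
    exact Pilipovic.mem_H_flat_iff hχ hσ.le hσ1 θ
  · rw [Pilipovic.ADual_flat_eq hσ]
    exact Pilipovic.mem_H₀_flat_iff hχ hσ hσ1 θ
  · rw [Pilipovic.A₀Dual_real_half_eq]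
    exact Pilipovic.mem_H_flat_iff hχ le_rfl one_half_lt_one θ
  · rw [Pilipovic.A₀_real_half_eq]
    exact Pilipovic.mem_H₀_flat_iff_half hχ one_half_pos one_half_lt_one
  · rw [Pilipovic.A_flat_eq hσ hσ']
    exact Pilipovic.mem_H_flat_iff_half hχ hσ (hσ'.trans one_half_lt_one)
  · rw [Pilipovic.A₀_flat_eq hσ hσ']
    exact Pilipovic.mem_H₀_flat_iff_half hχ hσ (hσ'.trans one_half_lt_one)
  · exact Pilipovic.mem_H_real_iff hχ hs hs'
  · exact Pilipovic.mem_H₀_real_iff hχ hs hs'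

theorem mainTheorem12 (d : ℕ) (χ : (Fin d → ℂ) → ℝ) (hχ : χ ∈ Pilipovic.RClass d)
    (f : (Fin d → ℝ) → ℂ) :
    -- orders `♭_σ` with `σ ∈ (1/2, 1)`
    (∀ σ : ℝ, 1 / 2 < σ → σ < 1 → ∀ θ ∈ ({1, 1 / 2} : Set ℝ),
      (f ∈ Pilipovic.H d (.flat σ) ↔
        Pilipovic.HasRepresentation θ χ (Pilipovic.A₀Dual d (.flat (σ / (2 * σ - 1)))) f) ∧
      (f ∈ Pilipovic.H₀ d (.flat σ) ↔
        Pilipovic.HasRepresentation θ χ (Pilipovic.ADual d (.flat (σ / (2 * σ - 1)))) f)) ∧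
    -- order `♭_{1/2}`
    (∀ θ ∈ ({1, 1 / 2} : Set ℝ),
      (f ∈ Pilipovic.H d (.flat (1 / 2)) ↔
        Pilipovic.HasRepresentation θ χ (Pilipovic.A₀Dual d (.real (1 / 2))) f)) ∧
    (f ∈ Pilipovic.H₀ d (.flat (1 / 2)) ↔
      Pilipovic.HasRepresentation (1 / 2) χ (Pilipovic.A₀ d (.real (1 / 2))) f) ∧
    -- orders `♭_σ` with `σ ∈ (0, 1/2)`
    (∀ σ : ℝ, 0 < σ → σ < 1 / 2 →
      (f ∈ Pilipovic.H d (.flat σ) ↔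
        Pilipovic.HasRepresentation (1 / 2) χ (Pilipovic.A d (.flat (σ / (1 - 2 * σ)))) f) ∧
      (f ∈ Pilipovic.H₀ d (.flat σ) ↔
        Pilipovic.HasRepresentation (1 / 2) χ (Pilipovic.A₀ d (.flat (σ / (1 - 2 * σ)))) f)) ∧
    -- real orders `s ∈ (0, 1/2)`
    (∀ s : ℝ, 0 < s → s < 1 / 2 →
      (f ∈ Pilipovic.H d (.real s) ↔
        Pilipovic.HasRepresentation (1 / 2) χ (Pilipovic.A d (.real s)) f) ∧
      (f ∈ Pilipovic.H₀ d (.real s) ↔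
        Pilipovic.HasRepresentation (1 / 2) χ (Pilipovic.A₀ d (.real s)) f)) :=
  have ⟨hflat, hhalf, hrest⟩ := mainTheorem12_general d χ hχ f
  ⟨fun σ hσ hσ1 θ _ => hflat σ hσ hσ1 θ, fun θ _ => hhalf θ, hrest⟩
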